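/- Let $d\ge 1$ and $\gamma\ge 1$ be integers, and let $V:\mathbb{R}^d\to\mathbb{C}$ be infinitely differentiable and compactly supported (for instance real-valued). Let $u_0\in H^\gamma(\mathbb{R}^d)\cap L^2(\mathbb{R}^d;|x|^{2\gamma}\,dx)$ be complex-valued. Then there is exactly one $$u\in C(\mathbb{R};H^\gamma(\mathbb{R}^d))\cap C(\mathbb{R};L^2(\mathbb{R}^d;|x|^{2\gamma}\,dx))$$ with $u(0)=u_0$ that solves $i\,\partial_t u+\Delta u=Vu$ on $\mathbb{R}^d\times\mathbb{R}$. Here the equation is understood in the sense of tempered distributions on $\mathbb{R}^d$ at every time $t\in\mathbb{R}$: for every Schwartz function $\varphi$ the function $t\mapsto\langle u(t),\varphi\rangle=\int_{\mathbb{R}^d}u(x,t)\varphi(x)\,dx$ is differentiable on $\mathbb{R}$ and $$i\,\frac{d}{dt}\langle u(t),\varphi\rangle+\langle u(t),\Delta\varphi\rangle=\langle V u(t),\varphi\rangle .$$ -/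

import Mathlib

open MeasureTheory TemperedDistribution
open scoped ENNReal SchwartzMap Laplacian ContDiff

noncomputable section

/-- The Euclidean space `ℝ^d`. -/
abbrev Rn (d : ℕ) : Type := EuclideanSpace ℝ (Fin d)

/-- The complex Lebesgue space `L²(ℝ^d)`. -/
abbrev L2 (d : ℕ) : Type := Lp ℂ 2 (volume : Measure (Rn d))

/-- An element of `L²(ℝ^d)`, seen as a tempered distribution. -/
def L2.toDist {d : ℕ} (f : L2 d) : 𝓢'(Rn d, ℂ) := (f : 𝓢'(Rn d, ℂ))

/-- The measure `|x|^{2γ} dx` on `ℝ^d`. -/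
def weightMeasure (d γ : ℕ) : Measure (Rn d) :=
  (volume : Measure (Rn d)).withDensity fun x ↦ ENNReal.ofReal (‖x‖ ^ (2 * γ))

/-- `f ∈ H^s(ℝ^d)`: the Bessel potential of order `s` of `f` lies in `L²(ℝ^d)`. -/
def MemH {d : ℕ} (s : ℝ) (f : L2 d) : Prop := MemSobolev s 2 f.toDist

/-- `f ∈ L²(ℝ^d; |x|^{2γ} dx)`. -/
def MemWeighted {d : ℕ} (γ : ℕ) (f : L2 d) : Prop := MemLp f 2 (weightMeasure d γ)

/-- `u ∈ C(ℝ; H^s(ℝ^d))`. Since the norm of `H^s(ℝ^d)` is `‖f‖_{H^s} = ‖J^s f‖_{L²}`, where `J^s` is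
the Bessel potential, this says that `J^s u(t)` lies in `L²(ℝ^d)` for every `t` and that
`t ↦ J^s u(t)` is continuous with values in `L²(ℝ^d)`. -/
def ContinuousInH {d : ℕ} (s : ℝ) (u : ℝ → L2 d) : Prop :=
  ∃ g : ℝ → L2 d, Continuous g ∧
    ∀ t, besselPotential (Rn d) ℂ s (u t).toDist = (g t).toDist

/-- `u ∈ C(ℝ; L²(ℝ^d; |x|^{2γ} dx))`: every `u(t)` lies in `L²(ℝ^d; |x|^{2γ} dx)`, and `u` is
continuous with values in that space. -/
def ContinuousInWeighted {d : ℕ} (γ : ℕ) (u : ℝ → L2 d) : Prop :=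
  ∃ h : ∀ t, MemWeighted γ (u t), Continuous fun t ↦ (h t).toLp (u t : Rn d → ℂ)

/-- The curve `u` of tempered distributions has the derivative `v` at time `t`, that is,
`⟨(u(τ) - u(t)) / (τ - t), φ⟩ → ⟨v, φ⟩` as `τ → t` for every Schwartz function `φ`. -/
def HasTimeDerivAt {d : ℕ} (u : ℝ → 𝓢'(Rn d, ℂ)) (v : 𝓢'(Rn d, ℂ)) (t : ℝ) : Prop :=
  ∀ φ : 𝓢(Rn d, ℂ), HasDerivAt (fun τ ↦ u τ φ) (v φ) t

/-- `u` solves `i ∂_t u + Δ u = V u` on `ℝ^d × ℝ` with `u(0) = u₀`: at every time `t` the identity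
holds between tempered distributions on `ℝ^d`. -/
def IsSchrodingerSolution {d : ℕ} (V : Rn d → ℂ) (u₀ : L2 d) (u : ℝ → L2 d) : Prop :=
  (∀ t, ∃ v : 𝓢'(Rn d, ℂ), HasTimeDerivAt (fun τ ↦ (u τ).toDist) v t ∧
    Complex.I • v + Δ (u t).toDist = smulLeftCLM ℂ V (u t).toDist) ∧
  u 0 = u₀

end

/-!
The equation is solved in the interaction picture. Write `w(t) = e^{-itΔ} u(t)`. Then
`i ∂_t u + Δ u = V u` becomes the linear equation `w' = A(t) w` with the bounded operators
`A(t) = -i e^{-itΔ} V e^{itΔ}` (`interaction`), which depend on `t` continuously in the strong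
topology. The Dyson series solves such an equation in any Banach space
(`exists_hasDerivAt_of_strongly_continuous`), and the solution is unique in `L²(ℝ^d)`.

For existence in `Σ = H^γ ∩ L²(|x|^{2γ} dx)`, the equation is solved in the Banach space `Σ` itself,
realized as the joint domain of the powers `xⱼ^γ` and `Dⱼ^γ` with its graph norm, where
`Dⱼ = (2πi)⁻¹ ∂ⱼ` (`jointDomain`). This requires that `e^{itΔ}` and `A(t)` map `Σ` to itself with
strongly continuous orbits. By the closed graph theorem and the uniform boundedness principle it is
enough that every single orbit is a continuous curve in `Σ` (`exists_strongly_continuous_lift`), so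
no operator norms on `Σ` have to be estimated. Along an orbit, the relations

* `x e^{itΔ} = e^{itΔ} (x + 4πt D)` and `D e^{itΔ} = e^{itΔ} D` (`posOp_freeDist`,
  `momOp_freeDist`),
* `x V = V x` and `D V = V D + (2πi)⁻¹ ∂V`

turn words of length at most `γ` in `x` and `D` into words of length at most `γ`. The class of
curves for which all such words are continuous in `L²` (`HasL2Words`) is therefore stable under the
propagator and under `V`. That the constant curves in `Σ` belong to this class is an interpolation
theorem (`hasL2Words_of_toDist`): if `f`, `xⁿ f` and `Dⁿ f` lie in `L²`, then so does `xʲ Dᵏ f` for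
`j + k ≤ n`. With `x` replaced by the bounded function `R sin(x / R)`, the numbers
`‖x^{n-k} Dᵏ f‖` form a logarithmically convex sequence up to lower order terms
(`CommutatorData.exists_bound`), with bounds uniform in `R`, and Fatou's lemma removes the
truncation.

For uniqueness, let `u` be a solution that is continuous in `L²`. Testing against Schwartz
functions, on which `e^{itΔ}` acts differentiably in time, shows that `w` has the distributional
derivative `A(t) w(t)`. This is a continuous curve in `L²`, so that `w' = A(t) w` holds in the
norm of `L²` (`IsSchrodingerSolution.hasDerivAt_interaction`), and Grönwall's inequality applies.
-/

/-! ### Linear equations with strongly continuous coefficients -/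

section StronglyContinuousFamilies

open Filter Topology Set

variable {E : Type*} [NormedAddCommGroup E] [NormedSpace ℂ E] [CompleteSpace E]

/-- The uniform boundedness principle, on bounded time intervals. -/
theorem exists_norm_le_of_strongly_continuous {A : ℝ → E →L[ℂ] E}
    (hA : ∀ x, Continuous fun t ↦ A t x) (R : ℝ) :
    ∃ C, 0 ≤ C ∧ ∀ t, |t| ≤ R → ‖A t‖ ≤ C := by
  have h : ∀ x, ∃ C, ∀ t : Icc (-R) R, ‖A t x‖ ≤ C := by
    intro x
    obtain ⟨C, hC⟩ := isCompact_Icc.exists_bound_of_continuousOn (s := Icc (-R) R)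
      (hA x).continuousOn
    exact ⟨C, fun t ↦ hC t t.2⟩
  obtain ⟨C, hC⟩ := banach_steinhaus (g := fun t : Icc (-R) R ↦ A t) h
  exact ⟨max C 0, le_max_right _ _, fun t ht ↦ (hC ⟨t, abs_le.1 ht⟩).trans (le_max_left _ _)⟩

theorem Continuous.clm_apply_of_strongly_continuous {A : ℝ → E →L[ℂ] E}
    (hA : ∀ x, Continuous fun t ↦ A t x) {w : ℝ → E} (hw : Continuous w) :
    Continuous fun t ↦ A t (w t) := by
  rw [continuous_iff_continuousAt]
  intro t
  obtain ⟨C, -, hC⟩ := exists_norm_le_of_strongly_continuous hA (|t| + 1)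
  have h1 : Tendsto (fun s ↦ A s (w s) - A s (w t)) (𝓝 t) (𝓝 0) := by
    have h2 : Tendsto (fun s ↦ C * ‖w s - w t‖) (𝓝 t) (𝓝 0) := by
      have : Continuous fun s ↦ C * ‖w s - w t‖ := by fun_prop
      simpa using this.tendsto t
    refine squeeze_zero_norm' ?_ h2
    have : ∀ᶠ s : ℝ in 𝓝 t, |s| < |t| + 1 :=
      continuous_abs.continuousAt.eventually (gt_mem_nhds (by linarith))
    filter_upwards [this] with s hs
    rw [← map_sub]
    exact (A s).le_of_opNorm_le (hC s hs.le) _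
  have h3 : Tendsto (fun s ↦ A s (w t)) (𝓝 t) (𝓝 (A t (w t))) := (hA (w t)).tendsto t
  simpa [ContinuousAt] using h1.add h3

/-- The terms of the Dyson series of the equation `w' = A(t) w`, `w(0) = x`. -/
noncomputable def dysonTerm (A : ℝ → E →L[ℂ] E) (x : E) : ℕ → ℝ → E
  | 0 => fun _ ↦ x
  | n + 1 => fun t ↦ ∫ s in (0 : ℝ)..t, A s (dysonTerm A x n s)

theorem continuous_dysonTerm {A : ℝ → E →L[ℂ] E} (hA : ∀ x, Continuous fun t ↦ A t x) (x : E)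
    (n : ℕ) : Continuous (dysonTerm A x n) := by
  induction n with
  | zero => exact continuous_const
  | succ n ih =>
    exact intervalIntegral.continuous_primitive
      (fun a b ↦ (Continuous.clm_apply_of_strongly_continuous hA ih).intervalIntegrable a b) 0

theorem norm_dysonTerm_le {A : ℝ → E →L[ℂ] E} (hA : ∀ x, Continuous fun t ↦ A t x) (x : E)
    {R C : ℝ} (hC0 : 0 ≤ C) (hC : ∀ t, |t| ≤ R → ‖A t‖ ≤ C) (n : ℕ) :
    ∀ t, |t| ≤ R → ‖dysonTerm A x n t‖ ≤ (C * |t|) ^ n / n.factorial * ‖x‖ := by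
  induction n with
  | zero => intro t _; simp [dysonTerm]
  | succ n ih =>
    intro t ht
    have hle : ∀ s ∈ Set.uIoc 0 t, |s| ≤ R := fun s hs ↦ by
      refine le_trans ?_ ht
      rcases le_total 0 t with h | h
      · rw [uIoc_of_le h] at hs
        rw [abs_of_pos hs.1, abs_of_nonneg h]; exact hs.2
      · rw [uIoc_of_ge h] at hs
        rw [abs_of_nonpos hs.2, abs_of_nonpos h]; linarith [hs.1]
    have hcont : Continuous fun s ↦ A s (dysonTerm A x n s) :=
      Continuous.clm_apply_of_strongly_continuous hA (continuous_dysonTerm hA x n)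
    calc ‖dysonTerm A x (n + 1) t‖
        ≤ ∫ s in Set.uIoc 0 t, ‖A s (dysonTerm A x n s)‖ :=
          intervalIntegral.norm_integral_le_integral_norm_uIoc
      _ ≤ ∫ s in Set.uIoc 0 t, (C ^ (n + 1) / n.factorial * ‖x‖) * |s - 0| ^ n := by
          apply setIntegral_mono_on
          · exact (hcont.norm.intervalIntegrable 0 t).def'
          · exact ((by fun_prop : Continuous fun s : ℝ ↦
              (C ^ (n + 1) / n.factorial * ‖x‖) * |s - 0| ^ n).intervalIntegrable 0 t).def'
          · exact measurableSet_uIoc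
          · intro s hs
            refine ((A s).le_of_opNorm_le (hC s (hle s hs)) _).trans ?_
            refine (mul_le_mul_of_nonneg_left (ih s (hle s hs)) hC0).trans (le_of_eq ?_)
            rw [sub_zero, mul_pow, pow_succ]; ring
      _ = (C * |t|) ^ (n + 1) / (n + 1).factorial * ‖x‖ := by
          rw [integral_const_mul, integral_pow_abs_sub_uIoc, sub_zero, Nat.factorial_succ]
          push_cast
          have : (n.factorial : ℝ) ≠ 0 := by positivity
          field_simp
          ring

/-- A linear equation `w' = A(t) w` with strongly continuous bounded operators `A(t)` has a global
solution, given by the Dyson series. -/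
theorem exists_hasDerivAt_of_strongly_continuous {A : ℝ → E →L[ℂ] E}
    (hA : ∀ x, Continuous fun t ↦ A t x) (x : E) :
    ∃ w : ℝ → E, w 0 = x ∧ ∀ t, HasDerivAt w (A t (w t)) t := by
  have hz : ∀ n, n ≠ 0 → dysonTerm A x n 0 = 0 := by
    intro n hn
    obtain ⟨m, rfl⟩ := Nat.exists_eq_succ_of_ne_zero hn
    simp [dysonTerm]
  have h0 : HasSum (fun n ↦ dysonTerm A x n 0) x := by
    have := hasSum_single (f := fun n ↦ dysonTerm A x n 0) 0 hz
    simpa [dysonTerm] using this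
  refine ⟨fun t ↦ ∑' n, dysonTerm A x n t, h0.tsum_eq, fun t ↦ ?_⟩
  set R := |t| + 1
  obtain ⟨C, hC0, hC⟩ := exists_norm_le_of_strongly_continuous hA R
  have hcont := fun n ↦
    Continuous.clm_apply_of_strongly_continuous hA (continuous_dysonTerm hA x n)
  let g' : ℕ → ℝ → E := fun n ↦ Nat.casesOn n (fun _ ↦ 0) fun m s ↦ A s (dysonTerm A x m s)
  let u : ℕ → ℝ := fun n ↦ Nat.casesOn n 0 fun m ↦ C * ((C * R) ^ m / m.factorial * ‖x‖)
  have hu : Summable u := by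
    rw [← summable_nat_add_iff 1]
    exact ((Real.summable_pow_div_factorial (C * R)).mul_right ‖x‖).mul_left C
  have hterm : ∀ n s, |s| ≤ R → ‖dysonTerm A x n s‖ ≤ (C * R) ^ n / n.factorial * ‖x‖ := by
    intro n s hs
    refine (norm_dysonTerm_le hA x hC0 hC n s hs).trans ?_
    gcongr
  have hsumm : Summable fun n ↦ dysonTerm A x n t :=
    Summable.of_norm_bounded ((Real.summable_pow_div_factorial (C * R)).mul_right ‖x‖)
      fun n ↦ hterm n t (by simp [R])
  have key : HasDerivAt (fun s ↦ ∑' n, dysonTerm A x n s) (∑' n, g' n t) t := by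
    refine hasDerivAt_tsum_of_isPreconnected (t := Metric.ball 0 R) hu Metric.isOpen_ball
      (convex_ball 0 R).isPreconnected (fun n s hs ↦ ?_) (fun n s hs ↦ ?_)
      (y₀ := 0) (by simp [R]; positivity) h0.summable (by simp [R])
    · cases n with
      | zero => exact hasDerivAt_const _ _
      | succ n =>
        exact intervalIntegral.integral_hasDerivAt_right ((hcont n).intervalIntegrable _ _)
          ((hcont n).stronglyMeasurableAtFilter _ _) (hcont n).continuousAt
    · have hs' : |s| ≤ R := by simpa using (Metric.mem_ball.1 hs).le
      cases n with
      | zero => simp [g', u]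
      | succ n =>
        exact ((A s).le_of_opNorm_le (hC s hs') _).trans
          (mul_le_mul_of_nonneg_left (hterm n s hs') hC0)
  convert key using 1
  rw [(A t).map_tsum hsumm]
  have hg' : Summable fun n ↦ g' n t := by
    rw [← summable_nat_add_iff 1]
    exact (A t).summable hsumm
  rw [hg'.tsum_eq_zero_add]
  simp [g']

variable {H : Type*} [NormedAddCommGroup H] [NormedSpace ℂ H]

/-- A bounded operator on `H` that leaves invariant a continuously embedded Banach space is
bounded there, by the closed graph theorem. -/
theorem exists_clm_lift {ι : E →L[ℂ] H} (hι : Function.Injective ι) (B : H →L[ℂ] H)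
    (hB : ∀ x, ∃ y, ι y = B (ι x)) : ∃ B' : E →L[ℂ] E, ∀ x, ι (B' x) = B (ι x) := by
  choose f hf using hB
  let L : E →ₗ[ℂ] E :=
    { toFun := f
      map_add' := fun x y ↦ hι (by simp [hf])
      map_smul' := fun c x ↦ hι (by simp [hf]) }
  have hL : IsClosed (L.graph : Set (E × E)) := by
    have : (L.graph : Set (E × E)) = {p | ι p.2 = B (ι p.1)} := by
      ext p
      simp only [SetLike.mem_coe, LinearMap.mem_graph_iff, mem_ofPred_eq]
      exact ⟨fun h ↦ by rw [h]; exact hf _, fun h ↦ hι (h.trans (hf _).symm)⟩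
    rw [this]
    exact isClosed_eq (by fun_prop) (by fun_prop)
  exact ⟨ContinuousLinearMap.ofIsClosedGraph hL, hf⟩

/-- If a family of bounded operators on `H` has orbits that are continuous curves in a continuously
embedded Banach space, then it restricts to a strongly continuous family of bounded operators on
that space. -/
theorem exists_strongly_continuous_lift {ι : E →L[ℂ] H} (hι : Function.Injective ι)
    (B : ℝ → H →L[ℂ] H) (hB : ∀ x, ∃ y : ℝ → E, Continuous y ∧ ∀ t, ι (y t) = B t (ι x)) :
    ∃ B' : ℝ → E →L[ℂ] E, (∀ x, Continuous fun t ↦ B' t x) ∧ ∀ t x, ι (B' t x) = B t (ι x) := by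
  have h : ∀ t, ∃ B' : E →L[ℂ] E, ∀ x, ι (B' x) = B t (ι x) := fun t ↦
    exists_clm_lift hι (B t) fun x ↦ by
      obtain ⟨y, -, hy⟩ := hB x
      exact ⟨y t, hy t⟩
  choose B' hB' using h
  refine ⟨B', fun x ↦ ?_, hB'⟩
  obtain ⟨y, hyc, hy⟩ := hB x
  have : (fun t ↦ B' t x) = y := funext fun t ↦ hι ((hB' t x).trans (hy t).symm)
  rwa [this]

end StronglyContinuousFamilies

/-! ### Square-integrable functions as tempered distributions -/

section LebesgueDistributions

open Filter Topology FourierTransform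

variable {d : ℕ}

theorem L2.toDist_apply (f : L2 d) (φ : 𝓢(Rn d, ℂ)) : f.toDist φ = ∫ x, φ x • f x :=
  Lp.toTemperedDistribution_apply f φ

/-- The embedding of `L²(ℝ^d)` into the tempered distributions, as a continuous linear map. -/
noncomputable def toDistCLM (d : ℕ) : L2 d →L[ℂ] 𝓢'(Rn d, ℂ) :=
  Lp.toTemperedDistributionCLM ℂ volume 2

theorem toDist_injective : Function.Injective (L2.toDist (d := d)) := by
  have h := Lp.ker_toTemperedDistributionCLM_eq_bot (E := Rn d) (F := ℂ) (μ := volume) (p := 2)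
  exact LinearMap.ker_eq_bot.1 h

theorem toDist_add (f g : L2 d) : (f + g).toDist = f.toDist + g.toDist := map_add (toDistCLM d) f g

theorem toDist_smul (c : ℂ) (f : L2 d) : (c • f).toDist = c • f.toDist :=
  map_smul (toDistCLM d) c f

theorem fourier_toDist (f : L2 d) : 𝓕 f.toDist = (𝓕 f : L2 d).toDist :=
  Lp.fourier_toTemperedDistribution_eq f

/-- For `f, h ∈ L²`, the distribution `m f` is `h` exactly when this holds almost everywhere. -/
theorem smulLeftCLM_toDist_eq_iff {m : Rn d → ℂ} (hm : m.HasTemperateGrowth) (f h : L2 d) :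
    smulLeftCLM ℂ m f.toDist = h.toDist ↔ (h : Rn d → ℂ) =ᵐ[volume] fun x ↦ m x * f x := by
  constructor
  · intro H
    have hf : LocallyIntegrable (f : Rn d → ℂ) := (Lp.memLp f).locallyIntegrable (by norm_num)
    have hh : LocallyIntegrable (h : Rn d → ℂ) := (Lp.memLp h).locallyIntegrable (by norm_num)
    have hmf : LocallyIntegrable fun x ↦ m x * f x := by
      simpa using hf.continuous_smul hm.1.continuous
    have hz : ∀ᵐ x, (h : Rn d → ℂ) x - m x * f x = 0 := by
      apply ae_eq_zero_of_integral_contDiff_smul_eq_zero (hh.sub hmf)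
      intro g g_smooth g_cpt
      have hg₁ : HasCompactSupport (Complex.ofRealCLM ∘ g) := g_cpt.comp_left rfl
      have hg₂ : ContDiff ℝ ∞ (Complex.ofRealCLM ∘ g) := by fun_prop
      have := DFunLike.congr_fun H (hg₁.toSchwartzMap hg₂)
      rw [smulLeftCLM_apply_apply, L2.toDist_apply, L2.toDist_apply] at this
      have e1 : ∫ x, g x • (h x - m x * f x) = (∫ x, g x • h x) - ∫ x, g x • (m x * f x) := by
        simp_rw [smul_sub]
        exact integral_sub (hh.integrable_smul_left_of_hasCompactSupport g_smooth.continuous g_cpt)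
          (hmf.integrable_smul_left_of_hasCompactSupport g_smooth.continuous g_cpt)
      refine e1.trans (sub_eq_zero.2 ?_)
      calc ∫ x, g x • (h : Rn d → ℂ) x = _ := by simp
        _ = _ := this.symm
        _ = _ := by
          congr 1 with x
          simp [SchwartzMap.smulLeftCLM_apply_apply hm]
          ring
    filter_upwards [hz] with x hx
    exact sub_eq_zero.1 hx
  · intro H
    ext φ
    rw [smulLeftCLM_apply_apply, L2.toDist_apply, L2.toDist_apply]
    apply integral_congr_ae
    filter_upwards [H] with x hx
    rw [hx, SchwartzMap.smulLeftCLM_apply_apply hm]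
    simp only [smul_eq_mul]
    ring

/-- The Fourier multiplier version of `smulLeftCLM_toDist_eq_iff`. -/
theorem fourierMultiplierCLM_toDist_eq_iff {m : Rn d → ℂ} (hm : m.HasTemperateGrowth)
    (f h : L2 d) : fourierMultiplierCLM ℂ m f.toDist = h.toDist ↔
      ((𝓕 h : L2 d) : Rn d → ℂ) =ᵐ[volume] fun x ↦ m x * (𝓕 f : L2 d) x := by
  rw [← smulLeftCLM_toDist_eq_iff hm, ← fourier_toDist, ← fourier_toDist,
    fourierMultiplierCLM_apply]
  constructor
  · intro H
    rw [← H, fourier_fourierInv_eq]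
  · intro H
    rw [H, fourierInv_fourier_eq]

/-- If `|m| ≤ C ∑ᵢ |mᵢ|` and the functions `mᵢ f(t)` are continuous curves in `L²`, then so
is `m f(t)`. -/
theorem exists_continuous_of_dominated {κ : Type*} [Fintype κ] {m : Rn d → ℂ} (hm : Continuous m)
    {n : κ → Rn d → ℂ} {C : ℝ} (hC : 0 ≤ C) (hmn : ∀ x, ‖m x‖ ≤ C * ∑ i, ‖n i x‖)
    (f : ℝ → L2 d) (g : κ → ℝ → L2 d) (hg : ∀ i, Continuous (g i))
    (hgf : ∀ i t, (g i t : Rn d → ℂ) =ᵐ[volume] fun x ↦ n i x * f t x) :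
    ∃ h : ℝ → L2 d, Continuous h ∧ ∀ t, (h t : Rn d → ℂ) =ᵐ[volume] fun x ↦ m x * f t x := by
  -- the function `∑ᵢ |gᵢ|` controls `m f` pointwise
  have bound : ∀ (a : L2 d) (b : κ → L2 d),
      (∀ i, (b i : Rn d → ℂ) =ᵐ[volume] fun x ↦ n i x * a x) →
      ∀ᵐ x, ‖m x * a x‖ ≤ C * ‖∑ i, ‖b i x‖‖ := by
    intro a b hab
    filter_upwards [ae_all_iff.2 hab] with x hx
    rw [Real.norm_of_nonneg (by positivity)]
    simp_rw [hx, norm_mul, ← Finset.sum_mul, ← mul_assoc]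
    gcongr
    exact hmn x
  have hsum : ∀ b : κ → L2 d, MemLp (fun x ↦ ∑ i, ‖b i x‖) 2 :=
    fun b ↦ memLp_finsetSum _ fun i _ ↦ (Lp.memLp (b i)).norm
  have hmem : ∀ t, MemLp (fun x ↦ m x * f t x) 2 := fun t ↦
    (hsum fun i ↦ g i t).of_le_mul
      (hm.aestronglyMeasurable.mul (Lp.aestronglyMeasurable (f t)))
      (bound (f t) (fun i ↦ g i t) fun i ↦ hgf i t)
  refine ⟨fun t ↦ (hmem t).toLp _, ?_, fun t ↦ (hmem t).coeFn_toLp⟩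
  rw [continuous_iff_continuousAt]
  intro t
  rw [ContinuousAt, tendsto_iff_norm_sub_tendsto_zero]
  have hlim : Tendsto (fun s ↦ C * ∑ i, ‖g i s - g i t‖) (𝓝 t) (𝓝 0) := by
    have : Continuous fun s ↦ C * ∑ i, ‖g i s - g i t‖ := by fun_prop
    simpa using this.tendsto t
  refine squeeze_zero (fun _ ↦ norm_nonneg _) (fun s ↦ ?_) hlim
  have h1 : ∀ᵐ x, ‖((hmem s).toLp _ - (hmem t).toLp _ : L2 d) x‖ ≤
      C * ‖((hsum fun i ↦ g i s - g i t).toLp _ : Lp ℝ 2 volume) x‖ := by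
    have hb := bound (f s - f t) (fun i ↦ g i s - g i t) fun i ↦ by
      filter_upwards [hgf i s, hgf i t, Lp.coeFn_sub (g i s) (g i t),
        Lp.coeFn_sub (f s) (f t)] with x h1 h2 h3 h4
      simp only [h3, h4, Pi.sub_apply, h1, h2]
      ring
    filter_upwards [hb, (hsum fun i ↦ g i s - g i t).coeFn_toLp, Lp.coeFn_sub (f s) (f t),
      Lp.coeFn_sub ((hmem s).toLp _) ((hmem t).toLp _), (hmem s).coeFn_toLp,
      (hmem t).coeFn_toLp] with x h1 h2 h3 h4 h5 h6
    rw [h2, h4, Pi.sub_apply, h5, h6, ← mul_sub]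
    rwa [h3, Pi.sub_apply] at h1
  refine (Lp.norm_le_mul_norm_of_ae_le_mul h1).trans (mul_le_mul_of_nonneg_left ?_ hC)
  have h2 : (hsum fun i ↦ g i s - g i t).toLp _
      = ∑ i, ((Lp.memLp (g i s - g i t)).norm.toLp _ : Lp ℝ 2 (volume : Measure (Rn d))) := by
    apply Lp.ext
    filter_upwards [(hsum fun i ↦ g i s - g i t).coeFn_toLp,
      Lp.coeFn_finsetSum Finset.univ (fun i ↦ ((Lp.memLp (g i s - g i t)).norm.toLp _ :
        Lp ℝ 2 (volume : Measure (Rn d)))),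
      ae_all_iff.2 fun i ↦ (Lp.memLp (g i s - g i t)).norm.coeFn_toLp] with x a1 a2 a3
    rw [a1, a2, Finset.sum_apply]
    exact Finset.sum_congr rfl fun i _ ↦ (a3 i).symm
  rw [h2]
  refine (norm_sum_le _ _).trans (Finset.sum_le_sum fun i _ ↦ ?_)
  rw [Lp.norm_toLp, eLpNorm_norm, ← Lp.norm_def]

/-- Multiplication by a bounded function, as an operator on `L²(ℝ^d)`. -/
noncomputable def mulOp (m : Rn d → ℂ) (hm : MemLp m ∞ volume) : L2 d →L[ℂ] L2 d :=
  (ContinuousLinearMap.lsmul ℂ ℂ).holderL volume ∞ 2 2 (hm.toLp m)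

theorem coeFn_mulOp {m : Rn d → ℂ} (hm : MemLp m ∞ volume) (f : L2 d) :
    (mulOp m hm f : Rn d → ℂ) =ᵐ[volume] fun x ↦ m x * f x := by
  filter_upwards [(ContinuousLinearMap.lsmul ℂ ℂ).coeFn_holder (r := 2) (hm.toLp m) f,
    hm.coeFn_toLp] with x h1 h2
  refine h1.trans ?_
  rw [h2]
  rfl

theorem toDist_mulOp {m : Rn d → ℂ} (hm : MemLp m ∞ volume) (hm' : m.HasTemperateGrowth)
    (f : L2 d) : (mulOp m hm f).toDist = smulLeftCLM ℂ m f.toDist :=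
  ((smulLeftCLM_toDist_eq_iff hm' f _).2 (coeFn_mulOp hm f)).symm

theorem norm_mulOp_le {m : Rn d → ℂ} (hm : MemLp m ∞ volume) {C : ℝ} (hC : ∀ x, ‖m x‖ ≤ C)
    (f : L2 d) : ‖mulOp m hm f‖ ≤ C * ‖f‖ := by
  apply Lp.norm_le_mul_norm_of_ae_le_mul
  filter_upwards [coeFn_mulOp hm f] with x hx
  rw [hx, norm_mul]
  gcongr
  exact hC x

theorem memLp_top_of_norm_le {m : Rn d → ℂ} (hm : Continuous m) {C : ℝ} (hC : ∀ x, ‖m x‖ ≤ C) :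
    MemLp m ∞ volume :=
  memLp_top_of_bound hm.aestronglyMeasurable C (ae_of_all _ hC)

end LebesgueDistributions

/-! ### The free propagator -/

section FreePropagator

open Filter Topology FourierTransform Function

variable {d : ℕ}

theorem hasTemperateGrowth_exp_I_mul :
    (fun s : ℝ ↦ Complex.exp (Complex.I * s)).HasTemperateGrowth := by
  have h : ∀ n : ℕ, iteratedDeriv n (fun s : ℝ ↦ Complex.exp (Complex.I * s)) =
      fun s : ℝ ↦ Complex.I ^ n * Complex.exp (Complex.I * s) := by
    intro n
    induction n with
    | zero => simp
    | succ n ih =>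
      rw [iteratedDeriv_succ, ih]
      ext s
      have h1 : HasDerivAt (fun s : ℝ ↦ Complex.I * (s : ℂ)) (Complex.I * 1) s :=
        (Complex.ofRealCLM.hasDerivAt (x := s)).const_mul _
      rw [(h1.cexp.const_mul (Complex.I ^ n)).deriv]
      ring
  refine ⟨(contDiff_const.mul Complex.ofRealCLM.contDiff).cexp, fun n ↦ ⟨0, 1, fun s ↦ ?_⟩⟩
  rw [norm_iteratedFDeriv_eq_norm_iteratedDeriv, h]
  simp [mul_comm Complex.I, Complex.norm_exp_ofReal_mul_I]

/-- The symbol `e^{-i t |2πξ|²}` of the free Schrödinger propagator. -/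
noncomputable def freeSymbol (t : ℝ) (ξ : Rn d) : ℂ :=
  Complex.exp (Complex.I * ((-(t * ((2 * Real.pi) ^ 2 * ‖ξ‖ ^ 2)) : ℝ) : ℂ))

theorem hasTemperateGrowth_freeSymbol (t : ℝ) :
    (freeSymbol t : Rn d → ℂ).HasTemperateGrowth :=
  hasTemperateGrowth_exp_I_mul.comp
    (by fun_prop : HasTemperateGrowth fun ξ : Rn d ↦ -(t * ((2 * Real.pi) ^ 2 * ‖ξ‖ ^ 2)))

theorem norm_freeSymbol (t : ℝ) (ξ : Rn d) : ‖freeSymbol t ξ‖ = 1 := by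
  rw [freeSymbol, mul_comm, Complex.norm_exp_ofReal_mul_I]

theorem freeSymbol_zero (ξ : Rn d) : freeSymbol 0 ξ = 1 := by simp [freeSymbol]

theorem freeSymbol_add (s t : ℝ) (ξ : Rn d) :
    freeSymbol (s + t) ξ = freeSymbol s ξ * freeSymbol t ξ := by
  rw [freeSymbol, freeSymbol, freeSymbol, ← Complex.exp_add]
  congr 1
  push_cast
  ring

theorem memLp_freeSymbol (t : ℝ) : MemLp (freeSymbol t : Rn d → ℂ) ∞ volume :=
  memLp_top_of_norm_le (hasTemperateGrowth_freeSymbol t).1.continuous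
    fun ξ ↦ (norm_freeSymbol t ξ).le

theorem norm_exp_I_mul_sub_le (θ : ℝ) :
    ‖Complex.exp (Complex.I * θ) - 1 - Complex.I * θ‖ ≤ 3 * θ ^ 2 := by
  have hn : ‖Complex.I * θ‖ = |θ| := by simp
  rcases le_total |θ| 1 with h | h
  · refine (Complex.norm_exp_sub_one_sub_id_le (hn.trans_le h)).trans ?_
    rw [hn, sq_abs]
    nlinarith [sq_nonneg θ]
  · refine (norm_sub_le _ _).trans ?_
    have h1 := (norm_sub_le (Complex.exp (Complex.I * θ)) 1)
    rw [mul_comm, Complex.norm_exp_ofReal_mul_I, mul_comm] at h1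
    rw [hn]
    have h2 : |θ| * |θ| = θ ^ 2 := by rw [← sq, sq_abs]
    have h3 : (1 : ℝ) ≤ |θ| * |θ| := by nlinarith
    have h4 : |θ| ≤ |θ| * |θ| := by nlinarith
    norm_num at h1
    linarith

/-- Multiplication by the symbol of the free propagator, on the Fourier side. -/
noncomputable def freeMul (t : ℝ) : L2 d →L[ℂ] L2 d := mulOp (freeSymbol t) (memLp_freeSymbol t)

theorem coeFn_freeMul (t : ℝ) (f : L2 d) :
    (freeMul t f : Rn d → ℂ) =ᵐ[volume] fun x ↦ freeSymbol t x * f x := coeFn_mulOp _ f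

theorem norm_freeMul_le (t : ℝ) (f : L2 d) : ‖freeMul t f‖ ≤ ‖f‖ := by
  simpa [freeMul] using norm_mulOp_le (memLp_freeSymbol t) (fun x ↦ (norm_freeSymbol t x).le) f

theorem freeMul_neg_freeMul (t : ℝ) (f : L2 d) : freeMul (-t) (freeMul t f) = f := by
  apply Lp.ext
  filter_upwards [coeFn_freeMul (-t) (freeMul t f), coeFn_freeMul t f] with x h1 h2
  rw [h1, h2, ← mul_assoc, ← freeSymbol_add, neg_add_cancel, freeSymbol_zero, one_mul]

theorem hasDerivAt_freeMul {g g₁ g₂ : L2 d}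
    (h₁ : (g₁ : Rn d → ℂ) =ᵐ[volume]
      fun x ↦ -Complex.I * ((2 * Real.pi) ^ 2 * ‖x‖ ^ 2 : ℝ) * g x)
    (h₂ : (g₂ : Rn d → ℂ) =ᵐ[volume] fun x ↦ (((2 * Real.pi) ^ 2 * ‖x‖ ^ 2) ^ 2 : ℝ) * g x)
    (t : ℝ) : HasDerivAt (fun s ↦ freeMul s g) (freeMul t g₁) t := by
  rw [hasDerivAt_iff_isLittleO]
  have key : ∀ s, ‖freeMul s g - freeMul t g - (s - t) • freeMul t g₁‖ ≤
      3 * (s - t) ^ 2 * ‖g₂‖ := by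
    intro s
    apply Lp.norm_le_mul_norm_of_ae_le_mul
    filter_upwards [Lp.coeFn_sub (freeMul s g - freeMul t g) ((s - t) • freeMul t g₁),
      Lp.coeFn_sub (freeMul s g) (freeMul t g), Lp.coeFn_smul (s - t) (freeMul t g₁),
      coeFn_freeMul s g, coeFn_freeMul t g, coeFn_freeMul t g₁, h₁, h₂]
      with x a1 a2 a3 a4 a5 a6 a7 a8
    rw [a1, Pi.sub_apply, a2, Pi.sub_apply, a3, Pi.smul_apply, a4, a5, a6, a7, a8]
    set q : ℝ := (2 * Real.pi) ^ 2 * ‖x‖ ^ 2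
    have e : freeSymbol s x =
        freeSymbol t x * Complex.exp (Complex.I * ((-((s - t) * q) : ℝ) : ℂ)) := by
      have := freeSymbol_add t (s - t) x
      rwa [add_sub_cancel] at this
    have e2 : freeSymbol s x * g x - freeSymbol t x * g x -
        (s - t) • (freeSymbol t x * (-Complex.I * (q : ℂ) * g x)) =
        freeSymbol t x * (Complex.exp (Complex.I * ((-((s - t) * q) : ℝ) : ℂ)) - 1 -
          Complex.I * ((-((s - t) * q) : ℝ) : ℂ)) * g x := by
      rw [e, Complex.real_smul]
      push_cast
      ring
    rw [e2, norm_mul, norm_mul, norm_freeSymbol, one_mul, norm_mul, Complex.norm_real,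
      Real.norm_of_nonneg (sq_nonneg q)]
    refine (mul_le_mul_of_nonneg_right (norm_exp_I_mul_sub_le (-((s - t) * q)))
      (norm_nonneg _)).trans (le_of_eq ?_)
    ring
  refine Asymptotics.IsBigO.trans_isLittleO (g := fun s ↦ (s - t) ^ 2) ?_ ?_
  · refine Asymptotics.IsBigO.of_bound (3 * ‖g₂‖) (Eventually.of_forall fun s ↦ ?_)
    refine (key s).trans (le_of_eq ?_)
    rw [Real.norm_of_nonneg (by positivity)]
    ring
  · have : (fun s : ℝ ↦ (s - t) ^ 2) =o[𝓝 t] fun s ↦ (s - t) ^ 1 := by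
      refine (Asymptotics.isLittleO_pow_pow one_lt_two).comp_tendsto (k := fun s : ℝ ↦ s - t) ?_
      have : Continuous fun s : ℝ ↦ s - t := by fun_prop
      simpa using this.tendsto t
    simpa using this

theorem SchwartzMap.coeFn_toLp_smulLeftCLM {m : Rn d → ℂ} (hm : m.HasTemperateGrowth)
    (φ : 𝓢(Rn d, ℂ)) :
    ((SchwartzMap.smulLeftCLM ℂ m φ).toLp 2 : Rn d → ℂ) =ᵐ[volume]
      fun x ↦ m x * (φ.toLp 2 : L2 d) x := by
  filter_upwards [(SchwartzMap.smulLeftCLM ℂ m φ).coeFn_toLp 2 volume,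
    φ.coeFn_toLp 2 volume] with x h1 h2
  rw [h1, h2, SchwartzMap.smulLeftCLM_apply_apply hm, smul_eq_mul]

theorem hasDerivAt_freeMul_toLp (φ : 𝓢(Rn d, ℂ)) (t : ℝ) :
    HasDerivAt (fun s ↦ freeMul s (φ.toLp 2))
      (freeMul t ((SchwartzMap.smulLeftCLM ℂ (fun x : Rn d ↦
        -Complex.I * ((2 * Real.pi) ^ 2 * ‖x‖ ^ 2 : ℝ)) φ).toLp 2)) t := by
  refine hasDerivAt_freeMul (g₂ := (SchwartzMap.smulLeftCLM ℂ (fun x : Rn d ↦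
    ((((2 * Real.pi) ^ 2 * ‖x‖ ^ 2) ^ 2 : ℝ) : ℂ)) φ).toLp 2) ?_ ?_ t
  · exact SchwartzMap.coeFn_toLp_smulLeftCLM (by fun_prop) φ
  · exact SchwartzMap.coeFn_toLp_smulLeftCLM (by fun_prop) φ

theorem continuous_freeMul (f : L2 d) : Continuous fun t ↦ freeMul t f := by
  refine DenseRange.induction_on (p := fun f : L2 d ↦ Continuous fun t ↦ freeMul t f)
    (SchwartzMap.denseRange_toLpCLM (p := 2) ENNReal.ofNat_ne_top) f ?_ ?_
  · refine IsSeqClosed.isClosed fun u g hu hg ↦ ?_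
    refine TendstoUniformly.continuous (p := atTop) (F := fun n t ↦ freeMul t (u n)) ?_
      (Frequently.of_forall hu)
    rw [Metric.tendstoUniformly_iff]
    intro ε hε
    filter_upwards [Metric.tendsto_nhds.1 hg ε hε] with n hn t
    rw [dist_eq_norm, ← map_sub]
    refine (norm_freeMul_le _ _).trans_lt ?_
    rwa [← dist_eq_norm, dist_comm]
  · intro φ
    exact continuous_iff_continuousAt.2 fun t ↦ (hasDerivAt_freeMul_toLp φ t).continuousAt

/-- The free Schrödinger propagator `e^{itΔ}` on `L²(ℝ^d)`. -/
noncomputable def free (t : ℝ) : L2 d →L[ℂ] L2 d :=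
  (fourierInvCLM ℂ (L2 d)) ∘L freeMul t ∘L (fourierCLM ℂ (L2 d))

theorem free_apply (t : ℝ) (f : L2 d) : free t f = 𝓕⁻ (freeMul t (𝓕 f)) := rfl

theorem free_neg_free (t : ℝ) (f : L2 d) : free (-t) (free t f) = f := by
  rw [free_apply, free_apply, fourier_fourierInv_eq, freeMul_neg_freeMul, fourierInv_fourier_eq]

theorem free_free_neg (t : ℝ) (f : L2 d) : free t (free (-t) f) = f := by
  simpa using free_neg_free (-t) f

theorem free_zero (f : L2 d) : free 0 f = f := by
  have : freeMul 0 (𝓕 f : L2 d) = 𝓕 f := by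
    apply Lp.ext
    filter_upwards [coeFn_freeMul 0 (𝓕 f : L2 d)] with x hx
    rw [hx, freeSymbol_zero, one_mul]
  rw [free_apply, this, fourierInv_fourier_eq]

theorem norm_free_le (t : ℝ) (f : L2 d) : ‖free t f‖ ≤ ‖f‖ := by
  rw [free_apply]
  have h1 : ‖(𝓕⁻ (freeMul t (𝓕 f)) : L2 d)‖ = ‖freeMul t (𝓕 f : L2 d)‖ := by
    rw [← Lp.norm_fourier_eq, fourier_fourierInv_eq]
  rw [h1]
  exact (norm_freeMul_le _ _).trans (Lp.norm_fourier_eq f).le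

theorem continuous_free (f : L2 d) : Continuous fun t ↦ free t f :=
  (fourierInvCLM ℂ (L2 d)).continuous.comp (continuous_freeMul _)

theorem toDist_free (t : ℝ) (f : L2 d) :
    (free t f).toDist = fourierMultiplierCLM ℂ (freeSymbol t) f.toDist := by
  symm
  rw [fourierMultiplierCLM_toDist_eq_iff (hasTemperateGrowth_freeSymbol t), free_apply,
    fourier_fourierInv_eq]
  exact coeFn_freeMul t _

/-- The transpose of the free propagator, acting on Schwartz functions. -/
noncomputable def freeTest (t : ℝ) (φ : 𝓢(Rn d, ℂ)) : 𝓢(Rn d, ℂ) :=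
  𝓕 (SchwartzMap.smulLeftCLM ℂ (freeSymbol t) (𝓕⁻ φ))

theorem toDist_free_apply (t : ℝ) (f : L2 d) (φ : 𝓢(Rn d, ℂ)) :
    (free t f).toDist φ = f.toDist (freeTest t φ) := by
  rw [toDist_free, fourierMultiplierCLM_apply_apply, freeTest]

theorem toLp_freeTest (t : ℝ) (φ : 𝓢(Rn d, ℂ)) :
    ((freeTest t φ).toLp 2 : L2 d) = 𝓕 (freeMul t ((𝓕⁻ φ).toLp 2)) := by
  rw [freeTest, ← SchwartzMap.toLp_fourier_eq]
  congr 1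
  apply Lp.ext
  filter_upwards [SchwartzMap.coeFn_toLp_smulLeftCLM (hasTemperateGrowth_freeSymbol t) (𝓕⁻ φ),
    coeFn_freeMul t ((𝓕⁻ φ).toLp 2)] with x h1 h2
  rw [h1, h2]

theorem fourierInv_laplacian (φ : 𝓢(Rn d, ℂ)) :
    𝓕⁻ (Δ φ) = SchwartzMap.smulLeftCLM ℂ (fun x : Rn d ↦
      -(((2 * Real.pi) ^ 2 * ‖x‖ ^ 2 : ℝ) : ℂ)) (𝓕⁻ φ) := by
  have h : Δ φ = 𝓕 (SchwartzMap.smulLeftCLM ℂ (fun x : Rn d ↦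
      -(((2 * Real.pi) ^ 2 * ‖x‖ ^ 2 : ℝ) : ℂ)) (𝓕⁻ φ)) := by
    ext x
    have h1 := DFunLike.congr_fun (laplacian_eq_fourierMultiplierCLM (delta x)) φ
    rw [laplacian_apply_apply, delta_apply] at h1
    rw [h1]
    have h2 : SchwartzMap.smulLeftCLM ℂ (fun x : Rn d ↦
        -(((2 * Real.pi) ^ 2 * ‖x‖ ^ 2 : ℝ) : ℂ)) (𝓕⁻ φ) =
        ((-(2 * Real.pi) ^ 2 : ℝ) : ℂ) • SchwartzMap.smulLeftCLM ℂ
          (fun x : Rn d ↦ ((‖x‖ ^ 2 : ℝ) : ℂ)) (𝓕⁻ φ) := by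
      ext y
      simp only [smul_apply]
      rw [SchwartzMap.smulLeftCLM_apply_apply (by fun_prop),
        SchwartzMap.smulLeftCLM_apply_apply (by fun_prop)]
      simp only [smul_eq_mul]
      push_cast
      ring
    rw [h2, FourierTransform.fourier_smul]
    simp only [smul_apply]
    rfl
  rw [h, fourierInv_fourier_eq]

theorem hasDerivAt_toLp_freeTest (φ : 𝓢(Rn d, ℂ)) (t : ℝ) :
    HasDerivAt (fun s ↦ ((freeTest s φ).toLp 2 : L2 d))
      (Complex.I • ((freeTest t (Δ φ)).toLp 2 : L2 d)) t := by
  simp_rw [toLp_freeTest]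
  have h := ((fourierCLM ℂ (L2 d)).restrictScalars ℝ).hasFDerivAt.comp_hasDerivAt t
    (hasDerivAt_freeMul_toLp (𝓕⁻ φ) t)
  refine h.congr_deriv ?_
  rw [fourierInv_laplacian]
  simp only [ContinuousLinearMap.coe_restrictScalars', fourierCLM_apply]
  rw [← FourierTransform.fourier_smul, ← map_smul]
  congr 2
  apply Lp.ext
  filter_upwards [Lp.coeFn_smul Complex.I ((SchwartzMap.smulLeftCLM ℂ (fun x : Rn d ↦
      -(((2 * Real.pi) ^ 2 * ‖x‖ ^ 2 : ℝ) : ℂ)) (𝓕⁻ φ)).toLp 2 : L2 d),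
    SchwartzMap.coeFn_toLp_smulLeftCLM (m := fun x : Rn d ↦
      -(((2 * Real.pi) ^ 2 * ‖x‖ ^ 2 : ℝ) : ℂ)) (by fun_prop) (𝓕⁻ φ),
    SchwartzMap.coeFn_toLp_smulLeftCLM (m := fun x : Rn d ↦
      -Complex.I * ((2 * Real.pi) ^ 2 * ‖x‖ ^ 2 : ℝ)) (by fun_prop) (𝓕⁻ φ)] with x h1 h2 h3
  rw [h1, Pi.smul_apply, h2, h3, smul_eq_mul]
  ring

end FreePropagator

/-! ### Position, momentum, and their commutation relations -/

section PositionMomentum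

open FourierTransform Function LineDeriv

variable {d : ℕ}

theorem SchwartzMap.lineDerivOp_smulLeftCLM {g g' : Rn d → ℂ} {e : Rn d}
    (hg : g.HasTemperateGrowth) (hg' : g'.HasTemperateGrowth) (h : ∀ x, fderiv ℝ g x e = g' x)
    (φ : 𝓢(Rn d, ℂ)) : ∂_{e} (SchwartzMap.smulLeftCLM ℂ g φ) =
      SchwartzMap.smulLeftCLM ℂ g (∂_{e} φ) + SchwartzMap.smulLeftCLM ℂ g' φ := by
  ext x
  rw [SchwartzMap.lineDerivOp_apply_eq_fderiv, add_apply, SchwartzMap.smulLeftCLM_apply_apply hg,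
    SchwartzMap.smulLeftCLM_apply_apply hg', SchwartzMap.lineDerivOp_apply_eq_fderiv]
  have e1 : (⇑(SchwartzMap.smulLeftCLM ℂ g φ) : Rn d → ℂ) = fun x ↦ g x * φ x := by
    ext y
    rw [SchwartzMap.smulLeftCLM_apply_apply hg, smul_eq_mul]
  rw [e1, fderiv_fun_mul (hg.1.differentiable (by simp) x) (φ.differentiable x)]
  simp [h, mul_comm]

/-- The product rule for the product of a tempered distribution and a function. -/
theorem lineDerivOp_smulLeftCLM {g g' : Rn d → ℂ} {e : Rn d}
    (hg : g.HasTemperateGrowth) (hg' : g'.HasTemperateGrowth) (h : ∀ x, fderiv ℝ g x e = g' x)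
    (f : 𝓢'(Rn d, ℂ)) :
    ∂_{e} (smulLeftCLM ℂ g f) = smulLeftCLM ℂ g (∂_{e} f) + smulLeftCLM ℂ g' f := by
  ext φ
  have := SchwartzMap.lineDerivOp_smulLeftCLM hg hg' h φ
  rw [lineDerivOp_apply_apply, smulLeftCLM_apply_apply, add_apply, smulLeftCLM_apply_apply,
    smulLeftCLM_apply_apply, lineDerivOp_apply_apply, this, ← map_add, map_neg]
  congr 1
  abel

/-- The linear function `x ↦ ⟨x, e⟩`, complex-valued. -/
noncomputable def coordFun (e x : Rn d) : ℂ := ((inner ℝ x e : ℝ) : ℂ)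

theorem hasTemperateGrowth_coordFun (e : Rn d) : (coordFun e).HasTemperateGrowth := by
  unfold coordFun
  fun_prop

/-- The position operator in the direction `e`: multiplication by `⟨x, e⟩`. -/
noncomputable def posOp (e : Rn d) : 𝓢'(Rn d, ℂ) →L[ℂ] 𝓢'(Rn d, ℂ) := smulLeftCLM ℂ (coordFun e)

/-- The momentum operator `(2πi)⁻¹ ∂_e` in the direction `e`, that is, the Fourier multiplier
`⟨ξ, e⟩`. -/
noncomputable def momOp (e : Rn d) : 𝓢'(Rn d, ℂ) →L[ℂ] 𝓢'(Rn d, ℂ) :=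
  fourierMultiplierCLM ℂ (coordFun e)

theorem lineDerivOp_eq_momOp (e : Rn d) (f : 𝓢'(Rn d, ℂ)) :
    ∂_{e} f = (2 * Real.pi * Complex.I) • momOp e f := lineDeriv_eq_fourierMultiplierCLM e f

theorem momOp_eq_lineDerivOp (e : Rn d) (f : 𝓢'(Rn d, ℂ)) :
    momOp e f = (2 * Real.pi * Complex.I)⁻¹ • ∂_{e} f := by
  rw [lineDerivOp_eq_momOp, smul_smul, inv_mul_cancel₀ Complex.two_pi_I_ne_zero, one_smul]

theorem momOp_smulLeftCLM {g g' : Rn d → ℂ} {e : Rn d}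
    (hg : g.HasTemperateGrowth) (hg' : g'.HasTemperateGrowth) (h : ∀ x, fderiv ℝ g x e = g' x)
    (f : 𝓢'(Rn d, ℂ)) : momOp e (smulLeftCLM ℂ g f) =
      smulLeftCLM ℂ g (momOp e f) + (2 * Real.pi * Complex.I)⁻¹ • smulLeftCLM ℂ g' f := by
  rw [momOp_eq_lineDerivOp, lineDerivOp_smulLeftCLM hg hg' h, momOp_eq_lineDerivOp, smul_add,
    map_smul]

theorem fderiv_coordFun (e v x : Rn d) : fderiv ℝ (coordFun e) x v = coordFun e v := by
  have : coordFun e = Complex.ofRealCLM ∘L (innerSL ℝ e) := by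
    ext y; simp [coordFun, real_inner_comm]
  rw [this, ContinuousLinearMap.fderiv, ← this]

theorem momOp_posOp (e : Rn d) (f : 𝓢'(Rn d, ℂ)) :
    momOp e (posOp e f) =
      posOp e (momOp e f) + ((2 * Real.pi * Complex.I)⁻¹ * coordFun e e) • f := by
  rw [posOp, momOp_smulLeftCLM (hasTemperateGrowth_coordFun e)
    (g' := fun _ ↦ coordFun e e) (by fun_prop) (fderiv_coordFun e e), smulLeftCLM_const, smul_smul]

theorem posOp_smulLeftCLM {g : Rn d → ℂ} (hg : g.HasTemperateGrowth) (e : Rn d)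
    (f : 𝓢'(Rn d, ℂ)) : posOp e (smulLeftCLM ℂ g f) = smulLeftCLM ℂ g (posOp e f) := by
  rw [posOp, smulLeftCLM_smulLeftCLM_apply hg (hasTemperateGrowth_coordFun e),
    smulLeftCLM_smulLeftCLM_apply (hasTemperateGrowth_coordFun e) hg, mul_comm]

/-- The free propagator `e^{itΔ}` on tempered distributions. -/
noncomputable def freeDist (t : ℝ) : 𝓢'(Rn d, ℂ) →L[ℂ] 𝓢'(Rn d, ℂ) :=
  fourierMultiplierCLM ℂ (freeSymbol t)

theorem momOp_freeDist (e : Rn d) (t : ℝ) (f : 𝓢'(Rn d, ℂ)) :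
    momOp e (freeDist t f) = freeDist t (momOp e f) := by
  rw [momOp, freeDist, fourierMultiplierCLM_fourierMultiplierCLM_apply
    (hasTemperateGrowth_freeSymbol t) (hasTemperateGrowth_coordFun e),
    fourierMultiplierCLM_fourierMultiplierCLM_apply
    (hasTemperateGrowth_coordFun e) (hasTemperateGrowth_freeSymbol t), mul_comm]

theorem fderiv_freeSymbol (e : Rn d) (t : ℝ) (ξ : Rn d) :
    fderiv ℝ (freeSymbol t) ξ e =
      (-2 * Complex.I * (t * (2 * Real.pi) ^ 2)) * (coordFun e ξ * freeSymbol t ξ) := by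
  have h1 : HasFDerivAt (fun ξ : Rn d ↦ -(t * ((2 * Real.pi) ^ 2 * ‖ξ‖ ^ 2)))
      (-(t • ((2 * Real.pi) ^ 2 • (2 • innerSL ℝ ξ)))) ξ :=
    (((hasStrictFDerivAt_norm_sq ξ).hasFDerivAt.const_mul _).const_mul _).neg
  have h2 := ((Complex.ofRealCLM.hasFDerivAt.comp ξ h1).const_mul Complex.I).cexp
  have h3 : HasFDerivAt (freeSymbol t : Rn d → ℂ) _ ξ := h2
  rw [h3.fderiv]
  simp [coordFun, freeSymbol, real_inner_comm]
  ring

/-- Multiplication by `⟨x, e⟩` and the free propagator: `x e^{itΔ} = e^{itΔ} (x + 4π t D)`, where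
`D = (2πi)⁻¹ ∂`. -/
theorem posOp_freeDist (e : Rn d) (t : ℝ) (f : 𝓢'(Rn d, ℂ)) :
    posOp e (freeDist t f) =
      freeDist t (posOp e f) + ((4 * Real.pi * t : ℝ) : ℂ) • freeDist t (momOp e f) := by
  have hX : ∀ T : 𝓢'(Rn d, ℂ),
      posOp e (𝓕⁻ T) = -(2 * Real.pi * Complex.I)⁻¹ • 𝓕⁻ (∂_{e} T) := by
    intro T
    rw [fourierInv_lineDerivOp_eq, smul_smul, neg_mul_neg,
      inv_mul_cancel₀ Complex.two_pi_I_ne_zero, one_smul]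
    rfl
  have hg := hasTemperateGrowth_freeSymbol (d := d) t
  have hc := hasTemperateGrowth_coordFun e
  have hfg : (coordFun e * freeSymbol t).HasTemperateGrowth := by fun_prop
  have hF : freeDist t f = 𝓕⁻ (smulLeftCLM ℂ (freeSymbol t) (𝓕 f)) := rfl
  rw [hF, hX, lineDerivOp_smulLeftCLM hg (g' := (-2 * Complex.I * (t * (2 * Real.pi) ^ 2)) •
    (coordFun e * freeSymbol t)) (by fun_prop) (fderiv_freeSymbol e t), smulLeftCLM_smul hfg,
    smul_apply, FourierTransform.fourierInv_add, FourierTransform.fourierInv_smul, smul_add,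
    smul_smul]
  congr 1
  · have : f = 𝓕⁻ (𝓕 f) := (fourierInv_fourier_eq f).symm
    rw [freeDist, fourierMultiplierCLM_apply]
    conv_rhs => rw [this, hX, FourierTransform.fourier_smul, fourier_fourierInv_eq, map_smul,
      FourierTransform.fourierInv_smul]
  · rw [freeDist, momOp, fourierMultiplierCLM_fourierMultiplierCLM_apply hc hg,
      fourierMultiplierCLM_apply]
    congr 1
    have := Complex.two_pi_I_ne_zero
    have hpi : (Real.pi : ℂ) ≠ 0 := by exact_mod_cast Real.pi_ne_zero
    push_cast
    field_simp
    ring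

end PositionMomentum

/-! ### Curves with square-integrable words in position and momentum -/

section Words

open Function

variable {d : ℕ}

/-- The curve `T` of tempered distributions is a continuous curve in `L²(ℝ^d)`. -/
def IsL2Curve (T : ℝ → 𝓢'(Rn d, ℂ)) : Prop :=
  ∃ g : ℝ → L2 d, Continuous g ∧ ∀ t, T t = (g t).toDist

theorem IsL2Curve.add {T T' : ℝ → 𝓢'(Rn d, ℂ)} (h : IsL2Curve T) (h' : IsL2Curve T') :
    IsL2Curve fun t ↦ T t + T' t := by
  obtain ⟨g, hg, hT⟩ := h
  obtain ⟨g', hg', hT'⟩ := h'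
  exact ⟨fun t ↦ g t + g' t, hg.add hg', fun t ↦ by simp only; rw [hT, hT', toDist_add]⟩

theorem IsL2Curve.smul {T : ℝ → 𝓢'(Rn d, ℂ)} (h : IsL2Curve T) {c : ℝ → ℂ} (hc : Continuous c) :
    IsL2Curve fun t ↦ c t • T t := by
  obtain ⟨g, hg, hT⟩ := h
  exact ⟨fun t ↦ c t • g t, hc.smul hg, fun t ↦ by simp only; rw [hT, toDist_smul]⟩

/-- The propagator `e^{iσ(t)Δ}`, with continuous `σ`, preserves continuous curves in `L²(ℝ^d)`. -/
theorem IsL2Curve.freeDist {T : ℝ → 𝓢'(Rn d, ℂ)} (h : IsL2Curve T) {σ : ℝ → ℝ}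
    (hσ : Continuous σ) : IsL2Curve fun t ↦ freeDist (σ t) (T t) := by
  obtain ⟨g, hg, hT⟩ := h
  exact ⟨fun t ↦ free (σ t) (g t), Continuous.clm_apply_of_strongly_continuous
    (fun x ↦ (continuous_free x).comp hσ) hg, fun t ↦ by simp only; rw [hT, toDist_free]; rfl⟩

theorem IsL2Curve.smulLeftCLM {T : ℝ → 𝓢'(Rn d, ℂ)} (h : IsL2Curve T) {V : Rn d → ℂ}
    (hV : V.HasTemperateGrowth) (hVb : MemLp V ∞ volume) :
    IsL2Curve fun t ↦ smulLeftCLM ℂ V (T t) := by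
  obtain ⟨g, hg, hT⟩ := h
  exact ⟨fun t ↦ mulOp V hVb (g t), (mulOp V hVb).continuous.comp hg,
    fun t ↦ by simp only; rw [hT, toDist_mulOp hVb hV]⟩

/-- All words of length at most `n` in the position and the momentum operator in the direction
`e`, applied to the curve `T` of tempered distributions, are continuous curves in `L²(ℝ^d)`. -/
def HasL2Words (e : Rn d) : ℕ → (ℝ → 𝓢'(Rn d, ℂ)) → Prop
  | 0, T => IsL2Curve T
  | n + 1, T => IsL2Curve T ∧ HasL2Words e n (fun t ↦ posOp e (T t)) ∧
      HasL2Words e n fun t ↦ momOp e (T t)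

namespace HasL2Words

variable {e : Rn d} {n : ℕ} {T T' : ℝ → 𝓢'(Rn d, ℂ)}

theorem add (h : HasL2Words e n T) (h' : HasL2Words e n T') :
    HasL2Words e n fun t ↦ T t + T' t := by
  induction n generalizing T T' with
  | zero => exact IsL2Curve.add h h'
  | succ n ih =>
    refine ⟨h.1.add h'.1, ?_, ?_⟩
    · simp only [map_add]
      exact ih h.2.1 h'.2.1
    · simp only [map_add]
      exact ih h.2.2 h'.2.2

theorem smul (h : HasL2Words e n T) {c : ℝ → ℂ} (hc : Continuous c) :
    HasL2Words e n fun t ↦ c t • T t := by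
  induction n generalizing T with
  | zero => exact IsL2Curve.smul h hc
  | succ n ih =>
    refine ⟨h.1.smul hc, ?_, ?_⟩
    · simp only [map_smul]
      exact ih h.2.1
    · simp only [map_smul]
      exact ih h.2.2

theorem of_succ (h : HasL2Words e (n + 1) T) : HasL2Words e n T := by
  induction n generalizing T with
  | zero => exact h.1
  | succ n ih => exact ⟨h.1, ih h.2.1, ih h.2.2⟩

theorem freeDist (h : HasL2Words e n T) {σ : ℝ → ℝ} (hσ : Continuous σ) :
    HasL2Words e n fun t ↦ freeDist (σ t) (T t) := by
  induction n generalizing T with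
  | zero => exact IsL2Curve.freeDist h hσ
  | succ n ih =>
    refine ⟨h.1.freeDist hσ, ?_, ?_⟩
    · simp only [posOp_freeDist]
      exact (ih h.2.1).add ((ih h.2.2).smul (by fun_prop))
    · simp only [momOp_freeDist]
      exact ih h.2.2

theorem smulLeftCLM (h : HasL2Words e n T) {V : Rn d → ℂ} (hV : ContDiff ℝ ∞ V)
    (hVc : HasCompactSupport V) : HasL2Words e n fun t ↦ smulLeftCLM ℂ V (T t) := by
  have L2 : ∀ {W : Rn d → ℂ} {S : ℝ → 𝓢'(Rn d, ℂ)}, ContDiff ℝ ∞ W → HasCompactSupport W →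
      IsL2Curve S → IsL2Curve fun t ↦ TemperedDistribution.smulLeftCLM ℂ W (S t) := by
    intro W S hW hWc hS
    obtain ⟨C, hC⟩ := hW.continuous.bounded_above_of_compact_support hWc
    exact hS.smulLeftCLM (hWc.hasTemperateGrowth hW) (memLp_top_of_norm_le hW.continuous hC)
  induction n generalizing T V with
  | zero => exact L2 hV hVc h
  | succ n ih =>
    have hV' : ContDiff ℝ ∞ fun x ↦ fderiv ℝ V x e :=
      (hV.fderiv_right (m := ∞) (by simp)).clm_apply contDiff_const
    have hVc' : HasCompactSupport fun x ↦ fderiv ℝ V x e := hVc.fderiv_apply ℝ e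
    refine ⟨L2 hV hVc h.1, ?_, ?_⟩
    · simp only [posOp_smulLeftCLM (hVc.hasTemperateGrowth hV)]
      exact ih h.2.1 hV hVc
    · simp only [momOp_smulLeftCLM (hVc.hasTemperateGrowth hV) (hVc'.hasTemperateGrowth hV')
        fun _ ↦ rfl]
      exact (ih h.2.2 hV hVc).add ((ih h.of_succ hV' hVc').smul continuous_const)

theorem posOp_iterate (h : HasL2Words e n T) : IsL2Curve fun t ↦ (posOp e)^[n] (T t) := by
  induction n generalizing T with
  | zero => exact h
  | succ n ih => exact ih h.2.1

theorem momOp_iterate (h : HasL2Words e n T) : IsL2Curve fun t ↦ (momOp e)^[n] (T t) := by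
  induction n generalizing T with
  | zero => exact h
  | succ n ih => exact ih h.2.2

end HasL2Words

theorem momOp_iterate_posOp (e : Rn d) (k : ℕ) (f : 𝓢'(Rn d, ℂ)) :
    (momOp e)^[k] (posOp e f) = posOp e ((momOp e)^[k] f) +
      (k * ((2 * Real.pi * Complex.I)⁻¹ * coordFun e e)) • (momOp e)^[k - 1] f := by
  have hz : ∀ S : 𝓢'(Rn d, ℂ), (0 : ℂ) • S = 0 := fun S ↦ by ext; simp
  induction k with
  | zero =>
    simp only [iterate_zero, id, Nat.cast_zero, zero_mul]
    exact (add_eq_left.2 (hz _)).symm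
  | succ k ih =>
    rw [iterate_succ_apply', ih, map_add, momOp_posOp, ← iterate_succ_apply' (momOp e), map_smul,
      ← iterate_succ_apply' (momOp e), add_assoc]
    congr 1
    cases k with
    | zero =>
      simp only [Nat.cast_zero, zero_mul, Nat.cast_one, zero_add, one_mul, iterate_zero, id]
      exact add_eq_left.2 (hz _)
    | succ k =>
      rw [Nat.add_sub_cancel, Nat.add_sub_cancel]
      refine (add_smul (_ : ℂ) _ ((momOp e)^[k + 1] f)).symm.trans ?_
      congr 1
      push_cast
      ring

/-- It suffices to consider the normally ordered words. -/
theorem HasL2Words.of_ordered {e : Rn d} {n : ℕ} {f : 𝓢'(Rn d, ℂ)}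
    (h : ∀ j k, j + k ≤ n → ∃ g : L2 d, (posOp e)^[j] ((momOp e)^[k] f) = g.toDist) :
    HasL2Words e n fun _ ↦ f := by
  have const : ∀ {f : 𝓢'(Rn d, ℂ)}, (∃ g : L2 d, f = g.toDist) → IsL2Curve fun _ ↦ f :=
    fun ⟨g, hg⟩ ↦ ⟨fun _ ↦ g, continuous_const, fun _ ↦ hg⟩
  induction n generalizing f with
  | zero => exact const (h 0 0 le_rfl)
  | succ n ih =>
    refine ⟨const (h 0 0 (Nat.zero_le _)), ih fun j k hjk ↦ ?_, ih fun j k hjk ↦ ?_⟩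
    · obtain ⟨g₁, h₁⟩ := h (j + 1) k (by omega)
      obtain ⟨g₂, h₂⟩ := h j (k - 1) (by omega)
      rw [momOp_iterate_posOp]
      have it : ∀ (S S' : 𝓢'(Rn d, ℂ)) (c : ℂ),
          (posOp e)^[j] (S + c • S') = (posOp e)^[j] S + c • (posOp e)^[j] S' := by
        intro S S' c
        clear h h₁ h₂ hjk
        induction j with
        | zero => rfl
        | succ j ih =>
          simp only [iterate_succ_apply'] at ih ⊢
          rw [ih, map_add, map_smul]
      rw [it, ← iterate_succ_apply, h₁, h₂, ← toDist_smul, ← toDist_add]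
      exact ⟨_, rfl⟩
    · rw [← iterate_succ_apply]
      exact h j (k + 1) (by omega)

end Words

/-! ### An abstract interpolation inequality -/

section Interpolation

open Function

/-- A nonnegative sequence that is logarithmically convex up to an error is bounded by its values
at the two ends, up to an additive constant. -/
theorem le_of_almost_log_convex {a : ℕ → ℝ} (ha : ∀ k, 0 ≤ a k) {n : ℕ} {M L : ℝ} (hL : 0 ≤ L)
    (h0 : a 0 ≤ M) (hn : a n ≤ M)
    (h : ∀ k, 1 ≤ k → k < n → a k ^ 2 ≤ a (k - 1) * a (k + 1) + L ^ 2) {k : ℕ} (hk : k ≤ n) :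
    a k ≤ M + (L + 1) * n ^ 2 := by
  -- adding `(L + 1) k²` rules out an interior maximum: there, `a (k - 1) + a (k + 1)` would be at
  -- most `2 (a k - (L + 1))`, and the inequality of arithmetic and geometric means
  -- contradicts the hypothesis
  obtain ⟨m, hm, hmax⟩ := Finset.exists_max_image (Finset.range (n + 1))
    (fun k ↦ a k + (L + 1) * (k : ℝ) ^ 2) ⟨0, by simp⟩
  simp only [Finset.mem_range, Nat.lt_succ_iff] at hm hmax
  have hk' := hmax k hk
  have hk0 : 0 ≤ (L + 1) * (k : ℝ) ^ 2 := by positivity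
  have hmn : (L + 1) * (m : ℝ) ^ 2 ≤ (L + 1) * (n : ℝ) ^ 2 := by gcongr
  by_cases hm0 : m = 0
  · subst hm0; linarith
  by_cases hm1 : m = n
  · subst hm1; linarith
  exfalso
  obtain ⟨p, rfl⟩ := Nat.exists_eq_succ_of_ne_zero hm0
  have h1 := hmax p (by omega)
  have h2 := hmax (p + 1 + 1) (by omega)
  have h3 := h (p + 1) (by omega) (by omega)
  simp only [Nat.add_sub_cancel, Nat.succ_eq_add_one] at h1 h2 h3
  push_cast at h1 h2
  have h4 : a p + a (p + 1 + 1) ≤ 2 * a (p + 1) - 2 * (L + 1) := by nlinarith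
  have h5 := ha p
  have h6 := ha (p + 1 + 1)
  have h7 : a p * a (p + 1 + 1) ≤ (a (p + 1) - (L + 1)) ^ 2 := by
    nlinarith [sq_nonneg (a p - a (p + 1 + 1))]
  nlinarith

variable {H : Type*} [NormedAddCommGroup H] [InnerProductSpace ℂ H]

/-- The commutator bounds behind the interpolation inequality. `D` is the graph of an unbounded
symmetric operator, `A` is a bounded symmetric operator, and `C` is, up to a constant, their
commutator. -/
structure CommutatorData (D : H → H → Prop) (A C : H →L[ℂ] H) (c : ℂ) : Prop where
  symm : ∀ u u' v v', D u u' → D v v' → inner ℂ u' v = inner ℂ u v'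
  comm : ∀ u u', D u u' → D (A u) (A u' + c • C u)
  norm_le : ‖c‖ ≤ 1 / 2
  symmA : ∀ u v, inner ℂ (A u) v = inner ℂ u (A v)
  normC : ∀ u, ‖C u‖ ≤ ‖u‖
  commute : ∀ u, A (C u) = C (A u)

namespace CommutatorData

variable {D : H → H → Prop} {A C : H →L[ℂ] H} {c : ℂ} (h : CommutatorData D A C c)

include h

theorem symm_iterate (p : ℕ) (u v : H) : inner ℂ (A^[p] u) v = inner ℂ u (A^[p] v) := by
  induction p generalizing u v with
  | zero => rfl
  | succ p ih => rw [iterate_succ_apply, ih, h.symmA, ← iterate_succ_apply' A]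

theorem commute_iterate (p : ℕ) (u : H) : A^[p] (C u) = C (A^[p] u) := by
  induction p with
  | zero => rfl
  | succ p ih => rw [iterate_succ_apply', ih, h.commute, ← iterate_succ_apply' A]

theorem iterate_comm (p : ℕ) {u u' : H} (hu : D u u') :
    D (A^[p] u) (A^[p] u' + (p * c) • C (A^[p - 1] u)) := by
  induction p with
  | zero => simpa using hu
  | succ p ih =>
    have := h.comm _ _ ih
    rw [← iterate_succ_apply' A] at this
    convert this using 1
    rw [map_add, map_smul, ← iterate_succ_apply' A, add_assoc]
    congr 1
    cases p with
    | zero => simp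
    | succ p =>
      rw [Nat.add_sub_cancel, Nat.add_sub_cancel, h.commute, ← iterate_succ_apply' A, ← add_smul]
      congr 1
      push_cast
      ring

/-- Moving one factor `D` across the inner product `⟪A^{p+1} D f, A^{p+1} D f⟫` and commuting it
past the powers of `A` gives logarithmic convexity up to a term of lower order. -/
theorem norm_sq_le {f₀ f₁ f₂ : H} (h₁ : D f₀ f₁) (h₂ : D f₁ f₂) (p : ℕ) :
    ‖A^[p + 1] f₁‖ ^ 2 ≤ ‖A^[p + 2] f₀‖ * ‖A^[p] f₂‖ +
      (p + 1) * (‖A^[p + 1] f₀‖ * ‖A^[p] f₁‖) := by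
  have e : (inner ℂ (A^[p + 1] f₁) (A^[p + 1] f₁) : ℂ) =
      inner ℂ (A^[p + 2] f₀) (A^[p] f₂) +
        ((2 * (p + 1) : ℕ) * c) * inner ℂ (A^[p + 1] f₀) (C (A^[p] f₁)) := by
    have a1 : (inner ℂ (A^[p + 2] f₀) (A^[p] f₂) : ℂ) = inner ℂ f₀ (A^[2 * (p + 1)] f₂) := by
      rw [h.symm_iterate, ← iterate_add_apply, show p + 2 + p = 2 * (p + 1) by omega]
    have a2 : (inner ℂ (A^[p + 1] f₀) (C (A^[p] f₁)) : ℂ) =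
        inner ℂ f₀ (C (A^[2 * (p + 1) - 1] f₁)) := by
      rw [h.symm_iterate, h.commute_iterate, ← iterate_add_apply,
        show p + 1 + p = 2 * (p + 1) - 1 by omega]
    rw [a1, a2, h.symm_iterate, ← iterate_add_apply, show p + 1 + (p + 1) = 2 * (p + 1) by omega,
      h.symm _ _ _ _ h₁ (h.iterate_comm _ h₂), inner_add_right, inner_smul_right]
  have e2 := congrArg norm e
  rw [inner_self_eq_norm_sq_to_K] at e2
  have e3 : ‖((‖A^[p + 1] f₁‖ : ℂ)) ^ 2‖ = ‖A^[p + 1] f₁‖ ^ 2 := by simp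
  refine (e3.symm.trans e2).le.trans ((norm_add_le _ _).trans ?_)
  refine add_le_add (norm_inner_le_norm _ _) ?_
  rw [norm_mul, norm_mul, Complex.norm_natCast]
  have h3 : ‖(inner ℂ (A^[p + 1] f₀) (C (A^[p] f₁)) : ℂ)‖ ≤ ‖A^[p + 1] f₀‖ * ‖A^[p] f₁‖ :=
    (norm_inner_le_norm _ _).trans (by gcongr; exact h.normC _)
  have h4 : ((2 * (p + 1) : ℕ) : ℝ) * ‖c‖ ≤ p + 1 := by
    push_cast
    nlinarith [h.norm_le, (Nat.cast_nonneg p : (0 : ℝ) ≤ p)]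
  gcongr

omit h

/-- The interpolation inequality: the norms of `Aʲ Dᵏ f` with `j + k ≤ n` are controlled by the
pure powers of `A` and of `D`, by a bound that does not depend on `A`. -/
theorem exists_bound (D : H → H → Prop) (c : ℂ) (M : ℝ) (n : ℕ) : ∃ K : ℝ, 0 ≤ K ∧
    ∀ A C : H →L[ℂ] H, CommutatorData D A C c → ∀ f : ℕ → H, (∀ k < n, D (f k) (f (k + 1))) →
      (∀ k ≤ n, ‖f k‖ ≤ M) → (∀ j ≤ n, ‖A^[j] (f 0)‖ ≤ M) →
      ∀ j k, j + k ≤ n → ‖A^[j] (f k)‖ ≤ K := by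
  induction n with
  | zero =>
    refine ⟨max M 0, le_max_right _ _, fun A C h f _ h1 _ j k hjk ↦ ?_⟩
    obtain ⟨rfl, rfl⟩ : j = 0 ∧ k = 0 := by omega
    exact (h1 0 le_rfl).trans (le_max_left _ _)
  | succ n ih =>
    obtain ⟨K, hK0, hK⟩ := ih
    refine ⟨max K (M + ((n + 1) * K + 1) * ((n + 1 : ℕ) : ℝ) ^ 2),
      le_max_of_le_left hK0, fun A C h f hf h1 h2 j k hjk ↦ ?_⟩
    have hK' := hK A C h f (fun k hk ↦ hf k (by omega)) (fun k hk ↦ h1 k (by omega))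
      fun j hj ↦ h2 j (by omega)
    rcases Nat.lt_or_ge (j + k) (n + 1) with hlt | hge
    · exact (hK' j k (by omega)).trans (le_max_left _ _)
    · refine le_trans ?_ (le_max_right _ _)
      have hj : j = n + 1 - k := by omega
      subst hj
      refine le_of_almost_log_convex (a := fun k ↦ ‖A^[n + 1 - k] (f k)‖)
        (fun _ ↦ norm_nonneg _) (by positivity) (h2 _ le_rfl) ?_ ?_ (by omega)
      · simpa using h1 (n + 1) le_rfl
      · intro k hk1 hkn
        obtain ⟨i, rfl⟩ := Nat.exists_eq_succ_of_ne_zero (by omega : k ≠ 0)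
        obtain ⟨p, hp⟩ := Nat.exists_eq_add_of_le (by omega : i + 1 + 1 ≤ n + 1)
        have e1 : n + 1 - i.succ = p + 1 := by omega
        have e2 : n + 1 - i = p + 2 := by omega
        have e3 : n + 1 - (i.succ + 1) = p := by omega
        rw [e1, e3, Nat.succ_eq_add_one, Nat.add_sub_cancel, e2]
        refine (h.norm_sq_le (hf i (by omega)) (hf (i + 1) (by omega)) p).trans ?_
        refine add_le_add le_rfl ?_
        have b1 := hK' (p + 1) i (by omega)
        have b2 := hK' p (i + 1) (by omega)
        have hpn : (p : ℝ) + 1 ≤ n + 1 := by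
          have : p ≤ n := by omega
          exact_mod_cast Nat.succ_le_succ this
        calc ((p : ℝ) + 1) * (‖A^[p + 1] (f i)‖ * ‖A^[p] (f (i + 1))‖)
            ≤ (n + 1) * (K * K) := by gcongr
          _ ≤ ((n + 1) * K) ^ 2 := by
            have : (0 : ℝ) ≤ n := Nat.cast_nonneg n
            nlinarith [mul_nonneg this (mul_nonneg hK0 hK0),
              mul_nonneg (mul_nonneg this this) (mul_nonneg hK0 hK0)]

end CommutatorData

end Interpolation

/-! ### Mixed position and momentum regularity -/

section MixedRegularity

open Function Filter Topology FourierTransform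

variable {d : ℕ}

theorem Real.hasTemperateGrowth_sin : Real.sin.HasTemperateGrowth := by
  have : Real.sin = Complex.imCLM ∘ fun s : ℝ ↦ Complex.exp (Complex.I * s) := by
    ext s
    simp [mul_comm Complex.I, Complex.exp_ofReal_mul_I_im]
  rw [this]
  exact Complex.imCLM.hasTemperateGrowth.comp hasTemperateGrowth_exp_I_mul

theorem Real.hasTemperateGrowth_cos : Real.cos.HasTemperateGrowth := by
  have : Real.cos = Complex.reCLM ∘ fun s : ℝ ↦ Complex.exp (Complex.I * s) := by
    ext s
    simp [mul_comm Complex.I, Complex.exp_ofReal_mul_I_re]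
  rw [this]
  exact Complex.reCLM.hasTemperateGrowth.comp hasTemperateGrowth_exp_I_mul

/-- The function `R sin(⟨x, e⟩ / R)`, a bounded substitute for `⟨x, e⟩`. -/
noncomputable def sinTrunc (e : Rn d) (R : ℝ) (x : Rn d) : ℂ :=
  ((R * Real.sin (R⁻¹ * inner ℝ x e) : ℝ) : ℂ)

/-- The derivative of `sinTrunc e R` in the direction of a unit vector `e`. -/
noncomputable def cosTrunc (e : Rn d) (R : ℝ) (x : Rn d) : ℂ :=
  ((Real.cos (R⁻¹ * inner ℝ x e) : ℝ) : ℂ)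

theorem hasTemperateGrowth_sinTrunc (e : Rn d) (R : ℝ) : (sinTrunc e R).HasTemperateGrowth := by
  have h1 : HasTemperateGrowth fun x : Rn d ↦ Real.sin (R⁻¹ * inner ℝ x e) :=
    Real.hasTemperateGrowth_sin.comp
      (by fun_prop : HasTemperateGrowth fun x : Rn d ↦ R⁻¹ * inner ℝ x e)
  unfold sinTrunc
  fun_prop

theorem hasTemperateGrowth_cosTrunc (e : Rn d) (R : ℝ) : (cosTrunc e R).HasTemperateGrowth := by
  have h1 : HasTemperateGrowth fun x : Rn d ↦ Real.cos (R⁻¹ * inner ℝ x e) :=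
    Real.hasTemperateGrowth_cos.comp
      (by fun_prop : HasTemperateGrowth fun x : Rn d ↦ R⁻¹ * inner ℝ x e)
  unfold cosTrunc
  fun_prop

theorem fderiv_sinTrunc {e : Rn d} (he : ‖e‖ = 1) {R : ℝ} (hR : R ≠ 0) (x : Rn d) :
    fderiv ℝ (sinTrunc e R) x e = cosTrunc e R x := by
  have h0 : HasFDerivAt (fun x : Rn d ↦ R⁻¹ * inner ℝ x e) (R⁻¹ • innerSL ℝ e) x := by
    have := ((innerSL ℝ e).hasFDerivAt (x := x)).const_mul R⁻¹
    simpa [real_inner_comm] using this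
  have h1 := Complex.ofRealCLM.hasFDerivAt.comp x (h0.sin.const_mul R)
  have h2 : HasFDerivAt (sinTrunc e R) _ x := h1
  rw [h2.fderiv]
  have hR' : (R : ℂ) ≠ 0 := by exact_mod_cast hR
  simp [cosTrunc, he]
  field_simp

theorem norm_sinTrunc_le (e : Rn d) (R : ℝ) (x : Rn d) : ‖sinTrunc e R x‖ ≤ |R| := by
  rw [sinTrunc, Complex.norm_real, Real.norm_eq_abs, abs_mul]
  exact mul_le_of_le_one_right (abs_nonneg _) (Real.abs_sin_le_one _)

theorem norm_sinTrunc_le_coordFun (e : Rn d) {R : ℝ} (hR : R ≠ 0) (x : Rn d) :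
    ‖sinTrunc e R x‖ ≤ ‖coordFun e x‖ := by
  rw [sinTrunc, coordFun, Complex.norm_real, Complex.norm_real, Real.norm_eq_abs, Real.norm_eq_abs,
    abs_mul]
  calc |R| * |Real.sin (R⁻¹ * inner ℝ x e)| ≤ |R| * |R⁻¹ * inner ℝ x e| := by
        exact mul_le_mul_of_nonneg_left Real.abs_sin_le_abs (abs_nonneg _)
    _ = |inner ℝ x e| := by
        rw [← abs_mul, mul_inv_cancel_left₀ hR]

theorem norm_cosTrunc_le (e : Rn d) (R : ℝ) (x : Rn d) : ‖cosTrunc e R x‖ ≤ 1 := by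
  rw [cosTrunc, Complex.norm_real, Real.norm_eq_abs]
  exact Real.abs_cos_le_one _

theorem tendsto_sinTrunc (e x : Rn d) :
    Tendsto (fun m : ℕ ↦ sinTrunc e (m + 1) x) atTop (𝓝 (coordFun e x)) := by
  have h0 : Tendsto (fun m : ℕ ↦ ((m : ℝ) + 1)⁻¹ * inner ℝ x e) atTop (𝓝 0) := by
    have := (tendsto_one_div_add_atTop_nhds_zero_nat (𝕜 := ℝ)).mul_const (inner ℝ x e)
    simpa [one_div] using this
  have h1 : Tendsto (fun m : ℕ ↦ inner ℝ x e * Real.sinc (((m : ℝ) + 1)⁻¹ * inner ℝ x e)) atTop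
      (𝓝 (inner ℝ x e)) := by
    have := ((Real.continuous_sinc.tendsto 0).comp h0).const_mul (inner ℝ x e)
    simpa using this
  refine ((Complex.continuous_ofReal.tendsto _).comp h1).congr fun m ↦ ?_
  simp only [Function.comp_apply, sinTrunc]
  congr 1
  have hm : (m : ℝ) + 1 ≠ 0 := by positivity
  by_cases hx : inner ℝ x e = 0
  · simp [hx]
  · rw [Real.sinc_of_ne_zero (by positivity)]
    field_simp

theorem inner_mulOp_of_real {m : Rn d → ℂ} (hm : MemLp m ∞ volume)
    (hr : ∀ x, starRingEnd ℂ (m x) = m x) (f g : L2 d) :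
    inner ℂ (mulOp m hm f) g = inner ℂ f (mulOp m hm g) := by
  rw [MeasureTheory.L2.inner_def, MeasureTheory.L2.inner_def]
  apply integral_congr_ae
  filter_upwards [coeFn_mulOp hm f, coeFn_mulOp hm g] with x h1 h2
  rw [h1, h2]
  simp only [RCLike.inner_apply, map_mul, hr]
  ring

theorem mulOp_comm {m m' : Rn d → ℂ} (hm : MemLp m ∞ volume) (hm' : MemLp m' ∞ volume)
    (f : L2 d) : mulOp m hm (mulOp m' hm' f) = mulOp m' hm' (mulOp m hm f) := by
  apply Lp.ext
  filter_upwards [coeFn_mulOp hm f, coeFn_mulOp hm' f, coeFn_mulOp hm (mulOp m' hm' f),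
    coeFn_mulOp hm' (mulOp m hm f)] with x h1 h2 h3 h4
  rw [h3, h4, h1, h2]
  ring

theorem coeFn_mulOp_iterate {m : Rn d → ℂ} (hm : MemLp m ∞ volume) (f : L2 d) (n : ℕ) :
    ((mulOp m hm)^[n] f : Rn d → ℂ) =ᵐ[volume] fun x ↦ m x ^ n * f x := by
  induction n with
  | zero => simp
  | succ n ih =>
    rw [iterate_succ_apply']
    filter_upwards [coeFn_mulOp hm ((mulOp m hm)^[n] f), ih] with x h1 h2
    rw [h1, h2, pow_succ]
    ring

/-- The momentum operator is symmetric on its domain in `L²(ℝ^d)`. -/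
theorem inner_momOp_symm (e : Rn d) {u u' v v' : L2 d} (hu : momOp e u.toDist = u'.toDist)
    (hv : momOp e v.toDist = v'.toDist) : inner ℂ u' v = inner ℂ u v' := by
  rw [momOp, fourierMultiplierCLM_toDist_eq_iff (hasTemperateGrowth_coordFun e)] at hu hv
  rw [← Lp.inner_fourier_eq, ← Lp.inner_fourier_eq u, MeasureTheory.L2.inner_def,
    MeasureTheory.L2.inner_def]
  apply integral_congr_ae
  filter_upwards [hu, hv] with x h1 h2
  rw [h1, h2]
  simp only [RCLike.inner_apply, map_mul, coordFun, Complex.conj_ofReal]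
  ring

theorem commutatorData_sinTrunc {e : Rn d} (he : ‖e‖ = 1) {R : ℝ} (hR : R ≠ 0) :
    CommutatorData (fun u u' : L2 d ↦ momOp e u.toDist = u'.toDist)
      (mulOp (sinTrunc e R) (memLp_top_of_norm_le (hasTemperateGrowth_sinTrunc e R).1.continuous
        (norm_sinTrunc_le e R)))
      (mulOp (cosTrunc e R) (memLp_top_of_norm_le (hasTemperateGrowth_cosTrunc e R).1.continuous
        (norm_cosTrunc_le e R)))
      (2 * Real.pi * Complex.I)⁻¹ where
  symm _ _ _ _ hu hv := inner_momOp_symm e hu hv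
  comm u u' hu := by
    rw [toDist_mulOp _ (hasTemperateGrowth_sinTrunc e R),
      momOp_smulLeftCLM (hasTemperateGrowth_sinTrunc e R) (hasTemperateGrowth_cosTrunc e R)
        (fderiv_sinTrunc he hR), hu, toDist_add, toDist_smul,
      toDist_mulOp _ (hasTemperateGrowth_sinTrunc e R),
      toDist_mulOp _ (hasTemperateGrowth_cosTrunc e R)]
  norm_le := by
    rw [norm_inv, norm_mul, norm_mul, Complex.norm_I, Complex.norm_real, Complex.norm_ofNat,
      Real.norm_of_nonneg Real.pi_nonneg, mul_one, one_div]
    apply inv_anti₀ two_pos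
    nlinarith [Real.pi_gt_three]
  symmA := inner_mulOp_of_real _ fun x ↦ by rw [sinTrunc, Complex.conj_ofReal]
  normC u := by simpa using norm_mulOp_le _ (norm_cosTrunc_le e R) u
  commute := mulOp_comm _ _

theorem hasTemperateGrowth_coordFun_pow (e : Rn d) (n : ℕ) :
    (coordFun e ^ n).HasTemperateGrowth := (hasTemperateGrowth_coordFun e).pow n

theorem posOp_iterate_eq (e : Rn d) (n : ℕ) (f : 𝓢'(Rn d, ℂ)) :
    (posOp e)^[n] f = smulLeftCLM ℂ (coordFun e ^ n) f := by
  induction n with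
  | zero =>
    have : (coordFun e ^ 0) = fun _ ↦ (1 : ℂ) := by ext; simp
    rw [this, smulLeftCLM_const]
    ext; simp
  | succ n ih =>
    rw [iterate_succ_apply', ih, posOp, smulLeftCLM_smulLeftCLM_apply
      (hasTemperateGrowth_coordFun_pow e n) (hasTemperateGrowth_coordFun e), pow_succ]

theorem momOp_iterate_eq (e : Rn d) (n : ℕ) (f : 𝓢'(Rn d, ℂ)) :
    (momOp e)^[n] f = fourierMultiplierCLM ℂ (coordFun e ^ n) f := by
  induction n with
  | zero =>
    have : (coordFun e ^ 0) = fun _ ↦ (1 : ℂ) := by ext; simp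
    rw [this, fourierMultiplierCLM_const]
    ext; simp
  | succ n ih =>
    rw [iterate_succ_apply', ih, momOp, fourierMultiplierCLM_fourierMultiplierCLM_apply
      (hasTemperateGrowth_coordFun_pow e n) (hasTemperateGrowth_coordFun e), pow_succ]

theorem exists_of_dominated {κ : Type*} [Fintype κ] {m : Rn d → ℂ} (hm : Continuous m)
    {n : κ → Rn d → ℂ} {C : ℝ} (hC : 0 ≤ C) (hmn : ∀ x, ‖m x‖ ≤ C * ∑ i, ‖n i x‖)
    (f : L2 d) (g : κ → L2 d)
    (hgf : ∀ i, (g i : Rn d → ℂ) =ᵐ[volume] fun x ↦ n i x * f x) :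
    ∃ h : L2 d, (h : Rn d → ℂ) =ᵐ[volume] fun x ↦ m x * f x := by
  obtain ⟨h, -, hh⟩ := exists_continuous_of_dominated hm hC hmn (fun _ ↦ f) (fun i _ ↦ g i)
    (fun _ ↦ continuous_const) fun i _ ↦ hgf i
  exact ⟨h 0, hh 0⟩

theorem exists_coordFun_pow_mul {e : Rn d} {n k : ℕ} (hk : k ≤ n) {f g : L2 d}
    (hg : (g : Rn d → ℂ) =ᵐ[volume] fun x ↦ coordFun e x ^ n * f x) :
    ∃ h : L2 d, (h : Rn d → ℂ) =ᵐ[volume] fun x ↦ (coordFun e ^ k) x * f x := by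
  refine exists_of_dominated (κ := Fin 2)
    (hasTemperateGrowth_coordFun_pow e k).1.continuous
    (n := ![fun _ ↦ 1, fun x ↦ coordFun e x ^ n]) zero_le_one (fun x ↦ ?_) f ![f, g] fun i ↦ ?_
  · simp only [Fin.sum_univ_two, Matrix.cons_val_zero, Matrix.cons_val_one, one_mul, norm_one,
      Pi.pow_apply, norm_pow]
    rcases le_total ‖coordFun e x‖ 1 with h | h
    · have := pow_le_one₀ (norm_nonneg _) h (n := k)
      have h2 : 0 ≤ ‖coordFun e x‖ ^ n := by positivity
      linarith
    · have := pow_le_pow_right₀ h hk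
      linarith
  · fin_cases i
    · simp
    · exact hg

/-- The interpolation theorem: if `f`, `xⁿ f` and `Dⁿ f` lie in `L²`, where `x` and `D` are the
position and the momentum in the direction `e`, then all words of length at most `n` in `x` and `D`
map `f` into `L²`. -/
theorem hasL2Words_of_toDist {e : Rn d} (he : ‖e‖ = 1) {n : ℕ} {f gX gD : L2 d}
    (hX : (posOp e)^[n] f.toDist = gX.toDist) (hD : (momOp e)^[n] f.toDist = gD.toDist) :
    HasL2Words e n fun _ ↦ f.toDist := by
  rw [posOp_iterate_eq, smulLeftCLM_toDist_eq_iff (hasTemperateGrowth_coordFun_pow e n)] at hX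
  rw [momOp_iterate_eq, fourierMultiplierCLM_toDist_eq_iff
    (hasTemperateGrowth_coordFun_pow e n)] at hD
  have hF : ∀ k, ∃ F : L2 d, k ≤ n → (momOp e)^[k] f.toDist = F.toDist := by
    intro k
    by_cases hk : k ≤ n
    · obtain ⟨h, hh⟩ := exists_coordFun_pow_mul hk hD
      refine ⟨𝓕⁻ h, fun _ ↦ ?_⟩
      rw [momOp_iterate_eq, fourierMultiplierCLM_toDist_eq_iff
        (hasTemperateGrowth_coordFun_pow e k), fourier_fourierInv_eq]
      exact hh
    · exact ⟨0, fun h ↦ absurd h hk⟩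
  choose F hF using hF
  have hF0 : F 0 = f := toDist_injective (hF 0 (Nat.zero_le _)).symm
  have hG : ∀ k, ∃ G : L2 d, k ≤ n →
      (G : Rn d → ℂ) =ᵐ[volume] fun x ↦ (coordFun e ^ k) x * f x := by
    intro k
    by_cases hk : k ≤ n
    · obtain ⟨h, hh⟩ := exists_coordFun_pow_mul hk hX
      exact ⟨h, fun _ ↦ hh⟩
    · exact ⟨0, fun h ↦ absurd h hk⟩
  choose G hG using hG
  obtain ⟨K, hK0, hK⟩ := CommutatorData.exists_bound
    (fun u u' : L2 d ↦ momOp e u.toDist = u'.toDist) (2 * Real.pi * Complex.I)⁻¹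
    (∑ k ∈ Finset.range (n + 1), (‖F k‖ + ‖G k‖)) n
  have hle : ∀ k ≤ n, ‖F k‖ + ‖G k‖ ≤ ∑ k ∈ Finset.range (n + 1), (‖F k‖ + ‖G k‖) := fun k hk ↦
    Finset.single_le_sum (f := fun k ↦ ‖F k‖ + ‖G k‖) (fun _ _ ↦ by positivity)
      (Finset.mem_range.2 (by omega))
  apply HasL2Words.of_ordered
  intro j k hjk
  rw [hF k (by omega), posOp_iterate_eq]
  -- the truncated weights are bounded in `L²` uniformly in the truncation, so that Fatou's lemma
  -- applies
  have hmem : MemLp (fun x ↦ (coordFun e ^ j) x * F k x) 2 := by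
    refine ⟨((hasTemperateGrowth_coordFun_pow e j).1.continuous.aestronglyMeasurable).mul
      (Lp.aestronglyMeasurable _), ?_⟩
    have hlim : ∀ᵐ x, Tendsto (fun m : ℕ ↦ sinTrunc e (m + 1) x ^ j * F k x) atTop
        (𝓝 ((coordFun e ^ j) x * F k x)) :=
      ae_of_all _ fun x ↦ ((tendsto_sinTrunc e x).pow j).mul_const _
    have hfatou := Lp.eLpNorm_lim_le_liminf_eLpNorm (p := 2)
      (f := fun m : ℕ ↦ fun x ↦ sinTrunc e (m + 1) x ^ j * F k x)
      (fun m ↦ (((hasTemperateGrowth_sinTrunc e (m + 1)).1.continuous.pow j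
        ).aestronglyMeasurable).mul (Lp.aestronglyMeasurable _)) _ hlim
    refine hfatou.trans_lt (lt_of_le_of_lt ?_ (ENNReal.ofReal_lt_top (r := K)))
    refine liminf_le_of_frequently_le' (Frequently.of_forall fun m ↦ ?_)
    have hm : (m : ℝ) + 1 ≠ 0 := by positivity
    have hbd := hK _ _ (commutatorData_sinTrunc he hm) F ?_ ?_ ?_ j k hjk
    · rw [← eLpNorm_congr_ae (coeFn_mulOp_iterate (memLp_top_of_norm_le
        (hasTemperateGrowth_sinTrunc e (m + 1)).1.continuous (norm_sinTrunc_le e (m + 1))) (F k) j),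
        ← Lp.enorm_def, ← ofReal_norm]
      exact ENNReal.ofReal_le_ofReal hbd
    · intro k hk
      rw [← hF k hk.le, ← hF (k + 1) hk, iterate_succ_apply']
    · intro k hk
      exact (le_add_of_nonneg_right (norm_nonneg _)).trans (hle k hk)
    · intro i hi
      refine le_trans ?_ ((le_add_of_nonneg_left (norm_nonneg _)).trans (hle i hi))
      apply Lp.norm_le_norm_of_ae_le
      filter_upwards [coeFn_mulOp_iterate (memLp_top_of_norm_le
        (hasTemperateGrowth_sinTrunc e (m + 1)).1.continuous (norm_sinTrunc_le e (m + 1))) (F 0) i,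
        hG i hi] with x h1 h2
      rw [h1, h2, hF0, norm_mul, norm_mul, norm_pow, Pi.pow_apply, norm_pow]
      gcongr
      exact norm_sinTrunc_le_coordFun e hm x
  exact ⟨hmem.toLp _, (smulLeftCLM_toDist_eq_iff (hasTemperateGrowth_coordFun_pow e j) _ _).2
    hmem.coeFn_toLp⟩

end MixedRegularity

/-! ### Sobolev and weighted spaces through pure powers -/

section SpaceCharacterizations

open Function Filter Topology FourierTransform

variable {d : ℕ}

/-- The standard basis vectors of `ℝ^d`. -/
noncomputable def basisVec (j : Fin d) : Rn d := EuclideanSpace.single j (1 : ℝ)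

theorem norm_basisVec (j : Fin d) : ‖basisVec j‖ = 1 := by simp [basisVec]

theorem coordFun_basisVec (j : Fin d) (x : Rn d) : coordFun (basisVec j) x = (x j : ℂ) := by
  simp [coordFun, basisVec, EuclideanSpace.inner_single_right]

/-- The weight `(1 + |x|²)^{n/2}`, the symbol of the Bessel potential. -/
noncomputable def japaneseBracket (n : ℕ) (x : Rn d) : ℂ :=
  (((1 + ‖x‖ ^ 2) ^ ((n : ℝ) / 2) : ℝ) : ℂ)

theorem hasTemperateGrowth_japaneseBracket (n : ℕ) :
    (japaneseBracket n : Rn d → ℂ).HasTemperateGrowth := by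
  unfold japaneseBracket
  fun_prop

theorem besselPotential_eq (n : ℕ) (f : 𝓢'(Rn d, ℂ)) :
    besselPotential (Rn d) ℂ (n : ℝ) f = fourierMultiplierCLM ℂ (japaneseBracket n) f := rfl

theorem one_le_norm_japaneseBracket (n : ℕ) (x : Rn d) : 1 ≤ ‖japaneseBracket n x‖ := by
  rw [japaneseBracket, Complex.norm_real, Real.norm_of_nonneg (by positivity)]
  exact Real.one_le_rpow (by nlinarith [sq_nonneg ‖x‖]) (by positivity)

theorem norm_pow_le_norm_japaneseBracket (n : ℕ) (x : Rn d) :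
    ‖x‖ ^ n ≤ ‖japaneseBracket n x‖ := by
  rw [japaneseBracket, Complex.norm_real, Real.norm_of_nonneg (by positivity)]
  calc ‖x‖ ^ n = (‖x‖ ^ 2) ^ ((n : ℝ) / 2) := by
        rw [← Real.rpow_natCast_mul (norm_nonneg _), ← Real.rpow_natCast]
        congr 1
        push_cast
        ring
    _ ≤ _ := Real.rpow_le_rpow (by positivity) (by linarith) (by positivity)

theorem norm_coordFun_le (j : Fin d) (x : Rn d) : ‖coordFun (basisVec j) x‖ ≤ ‖x‖ := by
  rw [coordFun_basisVec, Complex.norm_real]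
  exact PiLp.norm_apply_le x j

/-- The weight `(1 + |x|²)^{n/2}` is controlled by `1` and the pure powers `xⱼⁿ`. -/
theorem exists_norm_japaneseBracket_le (d n : ℕ) : ∃ C : ℝ, 0 ≤ C ∧ ∀ x : Rn d,
    ‖japaneseBracket n x‖ ≤
      C * ∑ i : Option (Fin d), ‖i.elim 1 fun j ↦ coordFun (basisVec j) x ^ n‖ := by
  refine ⟨((d : ℝ) + 1) ^ n, by positivity, fun x ↦ ?_⟩
  have h1 : ‖x‖ ≤ ∑ j, ‖x j‖ := by
    have : x = ∑ j, x j • basisVec j := by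
      ext i
      simp [basisVec, Finset.sum_apply, Pi.single_apply]
    calc ‖x‖ = ‖∑ j, x j • basisVec j‖ := by rw [← this]
      _ ≤ ∑ j, ‖x j • basisVec j‖ := norm_sum_le _ _
      _ = ∑ j, ‖x j‖ := by simp [norm_smul, norm_basisVec]
  have h2 : ‖japaneseBracket n x‖ ≤ (1 + ∑ j, ‖x j‖) ^ n := by
    rw [japaneseBracket, Complex.norm_real, Real.norm_of_nonneg (by positivity)]
    have hS : 0 ≤ ∑ j, ‖x j‖ := by positivity
    calc (1 + ‖x‖ ^ 2) ^ ((n : ℝ) / 2) ≤ ((1 + ∑ j, ‖x j‖) ^ 2) ^ ((n : ℝ) / 2) := by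
          apply Real.rpow_le_rpow (by positivity) _ (by positivity)
          nlinarith [norm_nonneg x]
      _ = (1 + ∑ j, ‖x j‖) ^ n := by
          rw [← Real.rpow_natCast_mul (by positivity), ← Real.rpow_natCast]
          congr 1
          push_cast
          ring
  have h3 : (1 + ∑ j, ‖x j‖) ^ n ≤ ((d : ℝ) + 1) ^ n * (1 + ∑ j, ‖x j‖ ^ n) := by
    have hmax : ∃ a : ℝ, 0 ≤ a ∧ (1 ≤ a) ∧ (∀ j, ‖x j‖ ≤ a) ∧ a ^ n ≤ 1 + ∑ j, ‖x j‖ ^ n := by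
      by_cases h : ∃ j, ∀ i, ‖x i‖ ≤ ‖x j‖ ∧ 1 ≤ ‖x j‖
      · obtain ⟨j, hj⟩ := h
        refine ⟨‖x j‖, norm_nonneg _, (hj j).2, fun i ↦ (hj i).1, ?_⟩
        have := Finset.single_le_sum (f := fun j ↦ ‖x j‖ ^ n) (fun _ _ ↦ by positivity)
          (Finset.mem_univ j)
        simp only at this
        linarith
      · refine ⟨1, zero_le_one, le_rfl, fun i ↦ ?_, ?_⟩
        · by_contra hi
          push Not at hi
          obtain ⟨j, -, hj⟩ := Finset.exists_max_image Finset.univ (fun j ↦ ‖x j‖)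
            ⟨i, Finset.mem_univ i⟩
          exact h ⟨j, fun k ↦ ⟨hj k (Finset.mem_univ k), hi.le.trans (hj i (Finset.mem_univ i))⟩⟩
        · rw [one_pow]
          have : 0 ≤ ∑ j, ‖x j‖ ^ n := by positivity
          linarith
    obtain ⟨a, ha0, ha1, ha, hpow⟩ := hmax
    calc (1 + ∑ j, ‖x j‖) ^ n ≤ (((d : ℝ) + 1) * a) ^ n := by
          have : ∑ j, ‖x j‖ ≤ ∑ _j : Fin d, a := Finset.sum_le_sum fun j _ ↦ ha j
          simp only [Finset.sum_const, Finset.card_univ, Fintype.card_fin, nsmul_eq_mul] at this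
          gcongr
          linarith
      _ ≤ _ := by
          rw [mul_pow]
          gcongr
  refine (h2.trans h3).trans (le_of_eq ?_)
  simp [Fintype.sum_option, coordFun_basisVec]

theorem MemH.exists_momOp_iterate {n : ℕ} {f : L2 d} (hf : MemH (n : ℝ) f) (j : Fin d) :
    ∃ g : L2 d, (momOp (basisVec j))^[n] f.toDist = g.toDist := by
  obtain ⟨(g : L2 d), hg⟩ := hf
  change besselPotential (Rn d) ℂ (n : ℝ) f.toDist = g.toDist at hg
  rw [besselPotential_eq, fourierMultiplierCLM_toDist_eq_iff
    (hasTemperateGrowth_japaneseBracket n)] at hg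
  obtain ⟨h, hh⟩ := exists_of_dominated (κ := Unit) (C := 1)
    (hasTemperateGrowth_coordFun_pow (basisVec j) n).1.continuous (n := fun _ ↦ japaneseBracket n)
    zero_le_one (fun x ↦ by
      simp only [Pi.pow_apply, norm_pow, Finset.univ_unique, Finset.sum_singleton, one_mul]
      exact (pow_le_pow_left₀ (norm_nonneg _) (norm_coordFun_le j x) n).trans
        (norm_pow_le_norm_japaneseBracket n x)) _ (fun _ ↦ 𝓕 g) fun _ ↦ hg
  refine ⟨𝓕⁻ h, ?_⟩
  rw [momOp_iterate_eq, fourierMultiplierCLM_toDist_eq_iff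
    (hasTemperateGrowth_coordFun_pow _ n), fourier_fourierInv_eq]
  exact hh

/-- A curve whose pure powers `xⱼⁿ u(t)` are continuous in `L²` stays continuous in `L²` after
multiplication by any function that is bounded by the weight `(1 + |x|²)^{n/2}`. -/
theorem exists_continuous_of_le_japaneseBracket {n : ℕ} {m : Rn d → ℂ} (hm : Continuous m)
    (hmn : ∀ x, ‖m x‖ ≤ ‖japaneseBracket n x‖) {f : ℝ → L2 d} (hf : Continuous f)
    {g : Fin d → ℝ → L2 d} (hg : ∀ j, Continuous (g j))
    (hfg : ∀ j t, (g j t : Rn d → ℂ) =ᵐ[volume] fun x ↦ coordFun (basisVec j) x ^ n * f t x) :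
    ∃ h : ℝ → L2 d, Continuous h ∧ ∀ t, (h t : Rn d → ℂ) =ᵐ[volume] fun x ↦ m x * f t x := by
  obtain ⟨C, hC, hle⟩ := exists_norm_japaneseBracket_le d n
  refine exists_continuous_of_dominated hm hC (fun x ↦ (hmn x).trans (hle x)) f
    (fun i ↦ i.elim f g) (fun i ↦ ?_) fun i t ↦ ?_
  · cases i with
    | none => exact hf
    | some j => exact hg j
  · cases i with
    | none => simp
    | some j => exact hfg j t

theorem ContinuousInH.of_momOp_iterate {n : ℕ} {u : ℝ → L2 d} (hu : Continuous u)
    (h : ∀ j, IsL2Curve fun t ↦ (momOp (basisVec j))^[n] (u t).toDist) :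
    ContinuousInH (n : ℝ) u := by
  choose g hg hgu using h
  obtain ⟨k, hk, hku⟩ := exists_continuous_of_le_japaneseBracket (n := n) (m := japaneseBracket n)
    (f := fun t ↦ 𝓕 (u t)) (g := fun j t ↦ 𝓕 (g j t))
    (hasTemperateGrowth_japaneseBracket n).1.continuous (fun _ ↦ le_rfl)
    ((fourierCLM ℂ (L2 d)).continuous.comp hu)
    (fun j ↦ (fourierCLM ℂ (L2 d)).continuous.comp (hg j)) fun j t ↦ by
      have := hgu j t
      simp only at this
      rw [momOp_iterate_eq, fourierMultiplierCLM_toDist_eq_iff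
        (hasTemperateGrowth_coordFun_pow _ n)] at this
      exact this
  refine ⟨fun t ↦ 𝓕⁻ (k t), (fourierInvCLM ℂ (L2 d)).continuous.comp hk, fun t ↦ ?_⟩
  simp only
  rw [besselPotential_eq, fourierMultiplierCLM_toDist_eq_iff
    (hasTemperateGrowth_japaneseBracket n), fourier_fourierInv_eq]
  exact hku t

theorem ContinuousInH.continuous {n : ℕ} {u : ℝ → L2 d} (h : ContinuousInH (n : ℝ) u) :
    Continuous u := by
  obtain ⟨g, hg, hgu⟩ := h
  obtain ⟨k, hk, hku⟩ := exists_continuous_of_dominated (κ := Unit) (C := 1) (m := fun _ ↦ 1)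
    continuous_const (n := fun _ ↦ japaneseBracket n) zero_le_one
    (fun x ↦ by simpa using one_le_norm_japaneseBracket n x) (fun t ↦ 𝓕 (u t))
    (fun _ t ↦ 𝓕 (g t)) (fun _ ↦ (fourierCLM ℂ (L2 d)).continuous.comp hg) fun _ t ↦ by
      have := hgu t
      rw [besselPotential_eq, fourierMultiplierCLM_toDist_eq_iff
        (hasTemperateGrowth_japaneseBracket n)] at this
      exact this
  have : u = fun t ↦ 𝓕⁻ (k t) := by
    ext1 t
    have : k t = 𝓕 (u t) := by
      apply Lp.ext
      filter_upwards [hku t] with x hx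
      rw [hx, one_mul]
    rw [this, fourierInv_fourier_eq]
  rw [this]
  exact (fourierInvCLM ℂ (L2 d)).continuous.comp hk

/-- The norm of `L²(|x|^{2n} dx)` is the `L²` norm after multiplication by `|x|ⁿ`. -/
theorem eLpNorm_weightMeasure (n : ℕ) (f : Rn d → ℂ) :
    eLpNorm f 2 (weightMeasure d n) =
      eLpNorm (fun x ↦ ((‖x‖ ^ n : ℝ) : ℂ) * f x) 2 (volume : Measure (Rn d)) := by
  rw [eLpNorm_eq_lintegral_rpow_enorm_toReal two_ne_zero ENNReal.ofNat_ne_top,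
    eLpNorm_eq_lintegral_rpow_enorm_toReal two_ne_zero ENNReal.ofNat_ne_top, weightMeasure,
    lintegral_withDensity_eq_lintegral_mul_non_measurable _ (by fun_prop)
      (ae_of_all _ fun _ ↦ ENNReal.ofReal_lt_top)]
  congr 2
  ext x
  rw [Pi.mul_apply, enorm_mul, ENNReal.mul_rpow_of_nonneg _ _ (by simp)]
  congr 1
  rw [← ofReal_norm, Complex.norm_real, Real.norm_of_nonneg (by positivity),
    ENNReal.ofReal_rpow_of_nonneg (by positivity) (by simp)]
  congr 1
  rw [mul_comm, pow_mul]
  simp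

theorem MemWeighted.exists_posOp_iterate {n : ℕ} {f : L2 d} (hf : MemWeighted n f) (j : Fin d) :
    ∃ g : L2 d, (posOp (basisVec j))^[n] f.toDist = g.toDist := by
  have hmem : MemLp (fun x ↦ ((‖x‖ ^ n : ℝ) : ℂ) * f x) 2 (volume : Measure (Rn d)) := by
    refine ⟨(by fun_prop : Continuous fun x : Rn d ↦ ((‖x‖ ^ n : ℝ) : ℂ)).aestronglyMeasurable.mul
      (Lp.aestronglyMeasurable f), ?_⟩
    rw [← eLpNorm_weightMeasure]
    exact hf.2
  obtain ⟨h, hh⟩ := exists_of_dominated (κ := Unit) (C := 1)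
    (hasTemperateGrowth_coordFun_pow (basisVec j) n).1.continuous
    (n := fun _ x ↦ ((‖x‖ ^ n : ℝ) : ℂ)) zero_le_one (fun x ↦ by
      simp only [Pi.pow_apply, norm_pow, Finset.univ_unique, Finset.sum_singleton, one_mul,
        Complex.norm_real, norm_norm]
      exact pow_le_pow_left₀ (norm_nonneg _) (norm_coordFun_le j x) n)
    f (fun _ ↦ hmem.toLp _) fun _ ↦ hmem.coeFn_toLp
  refine ⟨h, ?_⟩
  rw [posOp_iterate_eq, smulLeftCLM_toDist_eq_iff (hasTemperateGrowth_coordFun_pow _ n)]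
  exact hh

theorem ContinuousInWeighted.of_posOp_iterate {n : ℕ} {u : ℝ → L2 d} (hu : Continuous u)
    (h : ∀ j, IsL2Curve fun t ↦ (posOp (basisVec j))^[n] (u t).toDist) :
    ContinuousInWeighted n u := by
  choose g hg hgu using h
  obtain ⟨k, hk, hku⟩ := exists_continuous_of_le_japaneseBracket (n := n)
    (m := fun x ↦ ((‖x‖ ^ n : ℝ) : ℂ)) (f := u) (g := g) (by fun_prop) (fun x ↦ by
      rw [Complex.norm_real, Real.norm_of_nonneg (by positivity)]
      exact norm_pow_le_norm_japaneseBracket n x) hu hg fun j t ↦ by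
      have := hgu j t
      simp only at this
      rw [posOp_iterate_eq, smulLeftCLM_toDist_eq_iff
        (hasTemperateGrowth_coordFun_pow _ n)] at this
      exact this
  have hmem : ∀ t, MemLp (u t) 2 (weightMeasure d n) := by
    intro t
    refine ⟨(Lp.aestronglyMeasurable (u t)).mono_ac (withDensity_absolutelyContinuous _ _), ?_⟩
    rw [eLpNorm_weightMeasure, ← eLpNorm_congr_ae (hku t)]
    exact Lp.eLpNorm_lt_top _
  refine ⟨hmem, ?_⟩
  have hnorm : ∀ s t, ‖(hmem s).toLp (u s : Rn d → ℂ) - (hmem t).toLp (u t : Rn d → ℂ)‖ =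
      ‖k s - k t‖ := by
    intro s t
    rw [← MemLp.toLp_sub, Lp.norm_toLp, Lp.norm_def, eLpNorm_weightMeasure]
    congr 1
    apply eLpNorm_congr_ae
    filter_upwards [Lp.coeFn_sub (k s) (k t), hku s, hku t] with x h1 h2 h3
    rw [h1, Pi.sub_apply, Pi.sub_apply, h2, h3, mul_sub]
  rw [continuous_iff_continuousAt]
  intro t
  rw [ContinuousAt, tendsto_iff_norm_sub_tendsto_zero]
  simp only [hnorm]
  exact tendsto_iff_norm_sub_tendsto_zero.1 (hk.tendsto t)

end SpaceCharacterizations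

/-! ### Distributional time derivatives -/

section DualityPairing

open Filter Topology FourierTransform

variable {d : ℕ}

/-- The bilinear pairing `∫ f g` of two functions in `L²(ℝ^d)`. -/
noncomputable def l2Pairing (d : ℕ) : L2 d →L[ℝ] L2 d →L[ℝ] ℂ :=
  (ContinuousLinearMap.mul ℝ ℂ).lpPairing volume 2 2

theorem SchwartzMap.smul_toLp (c : ℂ) (φ : 𝓢(Rn d, ℂ)) :
    c • (φ.toLp 2 : L2 d) = (c • φ).toLp 2 :=
  (map_smul (SchwartzMap.toLpCLM ℂ ℂ 2 (volume : Measure (Rn d))) c φ).symm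

theorem toDist_apply_eq_l2Pairing (f : L2 d) (φ : 𝓢(Rn d, ℂ)) :
    f.toDist φ = l2Pairing d (φ.toLp 2) f := by
  rw [L2.toDist_apply, l2Pairing, ContinuousLinearMap.lpPairing_eq_integral]
  apply integral_congr_ae
  filter_upwards [φ.coeFn_toLp 2 volume] with x hx
  rw [hx]
  rfl

/-- A product rule for `B(g(s), u(s))` in which only `s ↦ B(g(t), u(s))` and `g` are differentiable
at `t`, while `u` is merely continuous. -/
theorem HasDerivAt.bilinear_of_continuousAt {E F G : Type*} [NormedAddCommGroup E]
    [NormedSpace ℝ E] [NormedAddCommGroup F] [NormedSpace ℝ F] [NormedAddCommGroup G]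
    [NormedSpace ℝ G] (B : E →L[ℝ] F →L[ℝ] G) {g : ℝ → E} {g' : E} {u : ℝ → F} {c : G} {t : ℝ}
    (hg : HasDerivAt g g' t) (hu : ContinuousAt u t) (hc : HasDerivAt (fun s ↦ B (g t) (u s)) c t) :
    HasDerivAt (fun s ↦ B (g s) (u s)) (B g' (u t) + c) t := by
  have h1 : HasDerivAt (fun s ↦ B (g s - g t) (u s)) (B g' (u t)) t := by
    rw [hasDerivAt_iff_tendsto_slope] at hg ⊢
    have h2 : Tendsto (fun s ↦ B (slope g t s) (u s)) (𝓝[≠] t) (𝓝 (B g' (u t))) :=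
      (B.isBoundedBilinearMap.continuous.tendsto (g', u t)).comp
        (hg.prodMk_nhds (hu.tendsto.mono_left nhdsWithin_le_nhds))
    refine h2.congr fun s ↦ ?_
    simp [slope_def_module]
  refine (h1.add hc).congr_of_eventuallyEq (Eventually.of_forall fun s ↦ ?_)
  simp

theorem laplacian_freeTest (t : ℝ) (φ : 𝓢(Rn d, ℂ)) :
    Δ (freeTest t φ) = freeTest t (Δ φ) := by
  rw [← fourier_fourierInv_eq (F := 𝓢(Rn d, ℂ)) (Δ (freeTest t φ)), fourierInv_laplacian,
    freeTest, freeTest, fourierInv_fourier_eq, fourierInv_laplacian]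
  congr 1
  ext x
  rw [SchwartzMap.smulLeftCLM_apply_apply (by fun_prop),
    SchwartzMap.smulLeftCLM_apply_apply (hasTemperateGrowth_freeSymbol t),
    SchwartzMap.smulLeftCLM_apply_apply (hasTemperateGrowth_freeSymbol t),
    SchwartzMap.smulLeftCLM_apply_apply (by fun_prop)]
  simp only [smul_eq_mul]
  ring

theorem hasDerivAt_toDist_free {w : ℝ → L2 d} {w' : L2 d} {t : ℝ} (hw : HasDerivAt w w' t)
    (φ : 𝓢(Rn d, ℂ)) : HasDerivAt (fun s ↦ (free s (w s)).toDist φ)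
      ((free t w').toDist φ + Complex.I * (free t (w t)).toDist (Δ φ)) t := by
  simp_rw [toDist_free_apply, toDist_apply_eq_l2Pairing]
  have h := (l2Pairing d).hasDerivAt_of_bilinear
    (fun _ ↦ hasDerivAt_toLp_freeTest φ t) (fun _ ↦ hw)
  refine h.congr_deriv ?_
  congr 1
  rw [SchwartzMap.smul_toLp, ← toDist_apply_eq_l2Pairing, ← toDist_apply_eq_l2Pairing, map_smul,
    smul_eq_mul]

/-- Passing to the interaction picture `e^{-itΔ} u(t)` removes the Laplacian from the time
derivative, even if `u` is differentiable only in the sense of distributions. -/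
theorem hasDerivAt_toDist_free_neg {u : ℝ → L2 d} (hu : Continuous u) {v : 𝓢'(Rn d, ℂ)} {t : ℝ}
    (hv : HasTimeDerivAt (fun τ ↦ (u τ).toDist) v t) (φ : 𝓢(Rn d, ℂ)) :
    HasDerivAt (fun s ↦ (free (-s) (u s)).toDist φ)
      ((v - Complex.I • Δ (u t).toDist) (freeTest (-t) φ)) t := by
  have hg : HasDerivAt (fun s ↦ ((freeTest (-s) φ).toLp 2 : L2 d))
      (-(Complex.I • ((freeTest (-t) (Δ φ)).toLp 2 : L2 d))) t := by
    have := (hasDerivAt_toLp_freeTest φ (-t)).scomp t (hasDerivAt_neg t)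
    simpa [Function.comp_def] using this
  have hc : HasDerivAt (fun s ↦ l2Pairing d ((freeTest (-t) φ).toLp 2) (u s))
      (v (freeTest (-t) φ)) t := by
    simpa only [toDist_apply_eq_l2Pairing] using hv (freeTest (-t) φ)
  have h := hg.bilinear_of_continuousAt (l2Pairing d) hu.continuousAt hc
  simp_rw [toDist_free_apply, toDist_apply_eq_l2Pairing]
  refine h.congr_deriv ?_
  rw [map_neg, SchwartzMap.smul_toLp, neg_apply, ← toDist_apply_eq_l2Pairing, map_smul,
    ← laplacian_freeTest, ← laplacian_apply_apply, sub_apply, smul_apply]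
  abel

/-- A curve that is differentiable when tested against a separating family of continuous linear
maps, with a derivative that is norm continuous, is differentiable in norm. -/
theorem hasDerivAt_of_separating {E G S : Type*} [NormedAddCommGroup E] [NormedSpace ℝ E]
    [CompleteSpace E] [NormedAddCommGroup G] [NormedSpace ℝ G] [CompleteSpace G]
    (L : S → E →L[ℝ] G) (hL : ∀ x y, (∀ φ, L φ x = L φ y) → x = y) {w a : ℝ → E}
    (ha : Continuous a) (h : ∀ φ s, HasDerivAt (fun s ↦ L φ (w s)) (L φ (a s)) s) (t : ℝ) :
    HasDerivAt w (a t) t := by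
  have hint : ∀ s, w s = w 0 + ∫ r in (0 : ℝ)..s, a r := by
    intro s
    refine hL _ _ fun φ ↦ ?_
    rw [map_add, ← (L φ).intervalIntegral_comp_comm (ha.intervalIntegrable 0 s),
      intervalIntegral.integral_eq_sub_of_hasDerivAt (fun r _ ↦ h φ r)
        (((L φ).continuous.comp ha).intervalIntegrable 0 s)]
    abel
  rw [funext hint]
  exact (ha.integral_hasStrictDerivAt 0 t).hasDerivAt.const_add (w 0)

/-- A curve in `L²(ℝ^d)` whose derivative in the sense of distributions is a continuous curve in
`L²(ℝ^d)` is differentiable in `L²(ℝ^d)`. -/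
theorem hasDerivAt_of_toDist {w a : ℝ → L2 d} (ha : Continuous a)
    (h : ∀ (φ : 𝓢(Rn d, ℂ)) s, HasDerivAt (fun s ↦ (w s).toDist φ) ((a s).toDist φ) s) (t : ℝ) :
    HasDerivAt w (a t) t := by
  refine hasDerivAt_of_separating (fun φ : 𝓢(Rn d, ℂ) ↦ l2Pairing d (φ.toLp 2))
    (fun f g hfg ↦ toDist_injective ?_) ha (fun φ s ↦ ?_) t
  · ext φ
    rw [toDist_apply_eq_l2Pairing, toDist_apply_eq_l2Pairing]
    exact hfg φ
  · simpa only [toDist_apply_eq_l2Pairing] using h φ s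

end DualityPairing

/-! ### The interaction picture -/

section InteractionPicture

open Filter Topology

variable {d : ℕ} {V : Rn d → ℂ}

/-- The potential in the interaction picture: the operator `-i e^{-itΔ} V e^{itΔ}`. A curve `u`
solves the Schrödinger equation exactly when `w(t) = e^{-itΔ} u(t)` solves `w' = A(t) w`, where `A`
is this family. -/
noncomputable def interaction (hVb : MemLp V ∞ volume) (t : ℝ) : L2 d →L[ℂ] L2 d :=
  -Complex.I • (free (-t) ∘L mulOp V hVb ∘L free t)

theorem interaction_apply (hVb : MemLp V ∞ volume) (t : ℝ) (f : L2 d) :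
    interaction hVb t f = -Complex.I • free (-t) (mulOp V hVb (free t f)) := rfl

theorem toDist_interaction (hVb : MemLp V ∞ volume) (hV : V.HasTemperateGrowth) (t : ℝ)
    (f : L2 d) : (interaction hVb t f).toDist =
      -Complex.I • freeDist (-t) (smulLeftCLM ℂ V (freeDist t f.toDist)) := by
  rw [interaction_apply, toDist_smul, toDist_free, toDist_mulOp hVb hV, toDist_free]
  rfl

theorem continuous_interaction (hVb : MemLp V ∞ volume) (f : L2 d) :
    Continuous fun t ↦ interaction hVb t f := by
  have h := Continuous.clm_apply_of_strongly_continuous (A := fun t ↦ free (-t))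
    (fun x : L2 d ↦ (continuous_free x).comp continuous_neg)
    ((mulOp V hVb).continuous.comp (continuous_free f))
  exact h.const_smul (-Complex.I)

theorem norm_interaction_le (hVb : MemLp V ∞ volume) (t : ℝ) (f : L2 d) :
    ‖interaction hVb t f‖ ≤ ‖mulOp V hVb‖ * ‖f‖ := by
  rw [interaction_apply, norm_smul, norm_neg, Complex.norm_I, one_mul]
  refine (norm_free_le _ _).trans (((mulOp V hVb).le_opNorm _).trans ?_)
  gcongr
  exact norm_free_le t f

theorem interaction_unique (hVb : MemLp V ∞ volume) {w₁ w₂ : ℝ → L2 d}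
    (h₁ : ∀ t, HasDerivAt w₁ (interaction hVb t (w₁ t)) t)
    (h₂ : ∀ t, HasDerivAt w₂ (interaction hVb t (w₂ t)) t) (h : w₁ 0 = w₂ 0) : w₁ = w₂ := by
  refine ODE_solution_unique_univ (v := fun t f ↦ interaction hVb t f) (s := fun _ ↦ Set.univ)
    (K := ‖mulOp V hVb‖₊) (t₀ := 0) (fun t ↦ ?_) (fun t ↦ ⟨h₁ t, trivial⟩)
    (fun t ↦ ⟨h₂ t, trivial⟩) h
  refine (LipschitzWith.of_dist_le_mul fun f g ↦ ?_).lipschitzOnWith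
  rw [dist_eq_norm, dist_eq_norm, ← map_sub]
  exact norm_interaction_le hVb t (f - g)

/-- A curve whose interaction picture solves the linear equation `w' = A(t) w` in `L²(ℝ^d)` solves
the Schrödinger equation. -/
theorem isSchrodingerSolution_of_interaction (hVb : MemLp V ∞ volume) (hV : V.HasTemperateGrowth)
    {w : ℝ → L2 d} (hw : ∀ t, HasDerivAt w (interaction hVb t (w t)) t) :
    IsSchrodingerSolution V (w 0) fun t ↦ free t (w t) := by
  refine ⟨fun t ↦ ⟨-Complex.I • smulLeftCLM ℂ V (free t (w t)).toDist +
    Complex.I • Δ (free t (w t)).toDist, fun φ ↦ ?_, ?_⟩, free_zero _⟩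
  · refine (hasDerivAt_toDist_free (hw t) φ).congr_deriv ?_
    rw [interaction_apply, map_smul, free_free_neg, toDist_smul, toDist_mulOp hVb hV, add_apply,
      smul_apply, smul_apply, laplacian_apply_apply, smul_eq_mul Complex.I]
  · rw [smul_add, smul_smul, smul_smul]
    simp

/-- In the interaction picture, an `L²`-continuous solution of the Schrödinger equation solves
`w' = A(t) w` in the norm of `L²(ℝ^d)`. -/
theorem IsSchrodingerSolution.hasDerivAt_interaction (hVb : MemLp V ∞ volume)
    (hV : V.HasTemperateGrowth) {u₀ : L2 d} {u : ℝ → L2 d} (hu : Continuous u)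
    (h : IsSchrodingerSolution V u₀ u) (t : ℝ) : HasDerivAt (fun s ↦ free (-s) (u s))
      (interaction hVb t (free (-t) (u t))) t := by
  set w : ℝ → L2 d := fun s ↦ free (-s) (u s)
  have hw : Continuous w := Continuous.clm_apply_of_strongly_continuous (A := fun t ↦ free (-t))
    (fun x : L2 d ↦ (continuous_free x).comp continuous_neg) hu
  have hA : Continuous fun s ↦ interaction hVb s (w s) :=
    Continuous.clm_apply_of_strongly_continuous (continuous_interaction hVb) hw
  refine hasDerivAt_of_toDist hA (fun φ s ↦ ?_) t
  -- the equation expresses the part of `∂_t u` that survives in the interaction picture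
  obtain ⟨v, hv, hveq⟩ := h.1 s
  have hv' : v - Complex.I • Δ (u s).toDist = -Complex.I • smulLeftCLM ℂ V (u s).toDist := by
    rw [← hveq, smul_add, smul_smul]
    simp [sub_eq_add_neg]
  have := hasDerivAt_toDist_free_neg hu hv φ
  rw [hv'] at this
  refine this.congr_deriv ?_
  rw [interaction_apply, free_free_neg, toDist_smul, smul_apply, smul_apply, toDist_free_apply,
    toDist_mulOp hVb hV]

end InteractionPicture

/-! ### Persistence of regularity -/

section JointDomain

open Filter Topology

variable {d : ℕ} {κ : Type*}

/-- The space of the `f ∈ L²(ℝ^d)` for which all `Pᵢ f` lie in `L²(ℝ^d)`, encoded as the space of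
the pairs `(f, (Pᵢ f)ᵢ)`. Its norm, inherited from the product, is the graph norm. -/
noncomputable def jointDomain (P : κ → 𝓢'(Rn d, ℂ) →L[ℂ] 𝓢'(Rn d, ℂ)) :
    Submodule ℂ (L2 d × (κ → L2 d)) :=
  ⨅ i, (P i ∘L toDistCLM d ∘L ContinuousLinearMap.fst ℂ (L2 d) (κ → L2 d) -
    toDistCLM d ∘L ContinuousLinearMap.proj i ∘L
      ContinuousLinearMap.snd ℂ (L2 d) (κ → L2 d)).ker

theorem mem_jointDomain {P : κ → 𝓢'(Rn d, ℂ) →L[ℂ] 𝓢'(Rn d, ℂ)}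
    {p : L2 d × (κ → L2 d)} :
    p ∈ jointDomain P ↔ ∀ i, P i p.1.toDist = (p.2 i).toDist := by
  simp only [jointDomain, Submodule.mem_iInf]
  exact forall_congr' fun i ↦ sub_eq_zero

theorem completeSpace_jointDomain (P : κ → 𝓢'(Rn d, ℂ) →L[ℂ] 𝓢'(Rn d, ℂ)) :
    CompleteSpace (jointDomain P) := by
  refine IsClosed.completeSpace_coe (hs := ?_)
  rw [jointDomain, Submodule.coe_iInf]
  exact isClosed_iInter fun i ↦ ContinuousLinearMap.isClosed_ker _

/-- The inclusion of `jointDomain P` into `L²(ℝ^d)`. -/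
noncomputable def jointDomainIncl (P : κ → 𝓢'(Rn d, ℂ) →L[ℂ] 𝓢'(Rn d, ℂ)) :
    jointDomain P →L[ℂ] L2 d :=
  ContinuousLinearMap.fst ℂ (L2 d) (κ → L2 d) ∘L (jointDomain P).subtypeL

variable {P : κ → 𝓢'(Rn d, ℂ) →L[ℂ] 𝓢'(Rn d, ℂ)}

theorem jointDomainIncl_injective : Function.Injective (jointDomainIncl P) := by
  rintro ⟨⟨f, a⟩, hp⟩ ⟨⟨g, b⟩, hq⟩ (hpq : f = g)
  subst hpq
  have : a = b := funext fun i ↦ toDist_injective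
    ((mem_jointDomain.1 hp i).symm.trans (mem_jointDomain.1 hq i))
  subst this
  rfl

theorem isL2Curve_jointDomainIncl {y : ℝ → jointDomain P} (hy : Continuous y) (i : κ) :
    IsL2Curve fun t ↦ P i (jointDomainIncl P (y t)).toDist :=
  ⟨fun t ↦ (y t : L2 d × (κ → L2 d)).2 i, by fun_prop, fun t ↦ mem_jointDomain.1 (y t).2 i⟩

theorem exists_continuous_jointDomain {f : ℝ → L2 d} (hf : Continuous f)
    (hP : ∀ i, IsL2Curve fun t ↦ P i (f t).toDist) :
    ∃ y : ℝ → jointDomain P, Continuous y ∧ ∀ t, jointDomainIncl P (y t) = f t := by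
  choose g hg hgf using hP
  exact ⟨fun t ↦ ⟨(f t, fun i ↦ g i t), mem_jointDomain.2 fun i ↦ hgf i t⟩, by fun_prop,
    fun _ ↦ rfl⟩

/-- The abstract persistence of regularity: if both the free propagator and the potential in the
interaction picture preserve the joint domain of the operators `Pᵢ`, with strongly continuous
orbits, then an initial value in the joint domain has a solution that is continuous there. -/
theorem exists_isSchrodingerSolution [Fintype κ] {V : Rn d → ℂ} (hVb : MemLp V ∞ volume)
    (hV : V.HasTemperateGrowth)
    (hfree : ∀ f : L2 d, (∀ i, ∃ g : L2 d, P i f.toDist = g.toDist) →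
      ∀ i, IsL2Curve fun t ↦ P i (free t f).toDist)
    (hint : ∀ f : L2 d, (∀ i, ∃ g : L2 d, P i f.toDist = g.toDist) →
      ∀ i, IsL2Curve fun t ↦ P i (interaction hVb t f).toDist)
    {u₀ : L2 d} (hu₀ : ∀ i, ∃ g : L2 d, P i u₀.toDist = g.toDist) :
    ∃ u : ℝ → L2 d, Continuous u ∧ (∀ i, IsL2Curve fun t ↦ P i (u t).toDist) ∧
      IsSchrodingerSolution V u₀ u := by
  have := completeSpace_jointDomain P
  have hmem : ∀ p : jointDomain P, ∀ i, ∃ g : L2 d, P i (jointDomainIncl P p).toDist = g.toDist :=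
    fun p i ↦ ⟨(p : L2 d × (κ → L2 d)).2 i, mem_jointDomain.1 p.2 i⟩
  obtain ⟨U, hU, hUι⟩ := exists_strongly_continuous_lift (jointDomainIncl_injective (P := P)) free
    fun p ↦ exists_continuous_jointDomain (continuous_free _) (hfree _ (hmem p))
  obtain ⟨A, hA, hAι⟩ := exists_strongly_continuous_lift (jointDomainIncl_injective (P := P))
    (interaction hVb)
    fun p ↦ exists_continuous_jointDomain (continuous_interaction hVb _) (hint _ (hmem p))
  choose g hg using hu₀
  obtain ⟨w, hw0, hw⟩ := exists_hasDerivAt_of_strongly_continuous hA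
    (⟨(u₀, g), mem_jointDomain.2 hg⟩ : jointDomain P)
  have hwc : Continuous w := continuous_iff_continuousAt.2 fun t ↦ (hw t).continuousAt
  have hUw : Continuous fun t ↦ U t (w t) := Continuous.clm_apply_of_strongly_continuous hU hwc
  have hwι : ∀ t, HasDerivAt (fun s ↦ jointDomainIncl P (w s))
      (interaction hVb t (jointDomainIncl P (w t))) t := by
    intro t
    rw [← hAι]
    exact ((jointDomainIncl P).restrictScalars ℝ).hasFDerivAt.comp_hasDerivAt t (hw t)
  refine ⟨fun t ↦ jointDomainIncl P (U t (w t)), (jointDomainIncl P).continuous.comp hUw,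
    isL2Curve_jointDomainIncl hUw, ?_⟩
  have h := isSchrodingerSolution_of_interaction hVb hV hwι
  rw [hw0] at h
  simp_rw [hUι]
  exact h

end JointDomain

/-! ### Well-posedness in the weighted Sobolev space -/

section WellPosedness

variable {d : ℕ}

/-- The powers `xⱼⁿ` of the position operators and `Dⱼⁿ` of the momentum operators, whose joint
domain is `Hⁿ(ℝ^d) ∩ L²(ℝ^d; |x|²ⁿ dx)`. -/
noncomputable def phaseSpacePow (d n : ℕ) :
    Fin d ⊕ Fin d → 𝓢'(Rn d, ℂ) →L[ℂ] 𝓢'(Rn d, ℂ) :=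
  Sum.elim (fun j ↦ posOp (basisVec j) ^ n) fun j ↦ momOp (basisVec j) ^ n

theorem HasL2Words.isL2Curve_phaseSpacePow {n : ℕ} {T : ℝ → 𝓢'(Rn d, ℂ)}
    (h : ∀ j, HasL2Words (basisVec j) n T) (i : Fin d ⊕ Fin d) :
    IsL2Curve fun t ↦ phaseSpacePow d n i (T t) := by
  rcases i with j | j
  · simpa [phaseSpacePow, FunLike.coe_pow_eq_iterate] using (h j).posOp_iterate
  · simpa [phaseSpacePow, FunLike.coe_pow_eq_iterate] using (h j).momOp_iterate

theorem hasL2Words_of_phaseSpacePow {n : ℕ} {f : L2 d}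
    (hf : ∀ i, ∃ g : L2 d, phaseSpacePow d n i f.toDist = g.toDist) (j : Fin d) :
    HasL2Words (basisVec j) n fun _ ↦ f.toDist := by
  obtain ⟨gX, hX⟩ := hf (Sum.inl j)
  obtain ⟨gD, hD⟩ := hf (Sum.inr j)
  simp only [phaseSpacePow, Sum.elim_inl, Sum.elim_inr, FunLike.coe_pow_eq_iterate] at hX hD
  exact hasL2Words_of_toDist (norm_basisVec j) hX hD

end WellPosedness

theorem lemma3p1 (d γ : ℕ) (hγ : 0 < γ) (V : Rn d → ℂ) (hV : ContDiff ℝ ∞ V)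
    (hVc : HasCompactSupport V) (u₀ : L2 d) (hu₀ : MemH (γ : ℝ) u₀) (hu₀w : MemWeighted γ u₀) :
    ∃! u : ℝ → L2 d, ContinuousInH (γ : ℝ) u ∧ ContinuousInWeighted γ u ∧
      IsSchrodingerSolution V u₀ u := by
  have hVg : V.HasTemperateGrowth := hVc.hasTemperateGrowth hV
  obtain ⟨C, hC⟩ := hVc.exists_bound_of_continuous hV.continuous
  have hVb : MemLp V ∞ volume := memLp_top_of_norm_le hV.continuous hC
  obtain ⟨u, huc, huP, husol⟩ := exists_isSchrodingerSolution (P := phaseSpacePow d γ) (u₀ := u₀)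
    hVb hVg
    (fun f hf ↦ HasL2Words.isL2Curve_phaseSpacePow fun j ↦ by
      simp_rw [toDist_free]
      exact (hasL2Words_of_phaseSpacePow hf j).freeDist continuous_id)
    (fun f hf ↦ HasL2Words.isL2Curve_phaseSpacePow fun j ↦ by
      simp_rw [toDist_interaction hVb hVg]
      exact ((((hasL2Words_of_phaseSpacePow hf j).freeDist continuous_id).smulLeftCLM hV
        hVc).freeDist continuous_neg).smul continuous_const)
    (by
      rintro (j | j)
      · simpa [phaseSpacePow, FunLike.coe_pow_eq_iterate] using hu₀w.exists_posOp_iterate j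
      · simpa [phaseSpacePow, FunLike.coe_pow_eq_iterate] using hu₀.exists_momOp_iterate j)
  refine ⟨u, ⟨ContinuousInH.of_momOp_iterate huc fun j ↦ ?_,
    ContinuousInWeighted.of_posOp_iterate huc fun j ↦ ?_, husol⟩, ?_⟩
  · simpa [phaseSpacePow, FunLike.coe_pow_eq_iterate] using huP (Sum.inr j)
  · simpa [phaseSpacePow, FunLike.coe_pow_eq_iterate] using huP (Sum.inl j)
  · rintro u' ⟨hu'H, -, hu'sol⟩
    have h := interaction_unique hVb
      (hu'sol.hasDerivAt_interaction hVb hVg hu'H.continuous)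
      (husol.hasDerivAt_interaction hVb hVg huc) (by rw [hu'sol.2, husol.2])
    funext t
    rw [← free_free_neg t (u' t), ← free_free_neg t (u t)]
    exact congrArg (free t) (congrFun h t)
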